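/- \textbf{Setting.} $\mathbf{LRR}$ (linear real rings) is the theory of non-trivial commutative rings ($0\neq 1$) with a partial order $\le$ such that $0\le 1$; $x\le y$ implies $x+z\le y+z$; for every $n\ge 1$ there is $x$ with $nx=1$; and for every $n\ge 1$, $0\le nx$ implies $0\le x$. Let $Y$ be a finite set of constant symbols and $X\subseteq Y$. Polynomials with rational coefficients have a well-defined value in every model of $\mathbf{LRR}$ that interprets $Y$. Let $F$ be a ground formula, i.e. a Boolean combination of atoms $p\le q$, $p=q$ with $p,q\in\mathbb{Q}[Y]$. Its consequence cone is $\mathbf{C}_X(F)=\{p\in\mathbb{Q}[X] : F\models_{\mathbf{LRR}} 0\le p\}$. For finite sets $Z,P$ of polynomials, $\langle Z\rangle$ is the ideal generated by $Z$, $\mathrm{cone}(P)$ is the set of combinations of elements of $P$ with non-negative rational coefficients, and $\mathrm{alg.cone}_X(Z,P)=\langle Z\rangle+\mathrm{cone}(P)\subseteq\mathbb{Q}[X]$ for $Z,P\subseteq\mathbb{Q}[X]$. Fix a monomial ordering $\preceq$ on the monomials over $Y$. For a Gröbner basis $G$, $\mathrm{red}_G(p)$ is the polynomial $q$ with $p-q\in\langle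 G\rangle$ none of whose monomials is divisible by a leading monomial of an element of $G$. A pair $\langle Z,P\rangle$ is \emph{reduced} if $Z$ is a Gröbner basis of $\langle Z\rangle$ and $\mathrm{red}_Z(p)=p$ for all $p\in P$. \textbf{Subroutines.} \begin{itemize} \item $\mathrm{reduce}(Z,P)=\langle G,\{\mathrm{red}_G(p):p\in P\}\setminus\{0\}\rangle$ for a Gröbner basis $G$ of $\langle Z\rangle$ with respect to $\preceq$. \item $\mathrm{saturate}(Q)$: start with $\langle\emptyset,Q\cup\{1\}\rangle$; while there is a non-zero $t$ with $t,-t\in\mathrm{cone}(P)$, replace $\langle Z,P\rangle$ by $\mathrm{reduce}(Z\cup\{t\},P)$. \item $\mathrm{project}_X(Z,P)$: compute a Gröbner basis $G$ of $\langle Z\rangle$ with respect to the elimination ordering (compare the parts of the monomials outside $X$ first, then the parts over $X$); return $G\cap\mathbb{Q}[X]$, together with the result of Fourier--Motzkin elimination, from $\{\mathrm{red}_G(p):p\in P\}$, of all monomials that are not over $X$. \item $\mathrm{intersect}(Z_1,P_1,Z_2,P_2)=\mathrm{project}_X(tZ_1\cup(1-t)Z_2,\;tP_1\cup(1-t)P_2)$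 with a new variable $t$. \item Satisfiability of $G$ and $\mathrm{get\text{-}model}(G)$: write $G$ in disjunctive normal form, with cubes $\bigwedge_{p\in A}0\le p\wedge\bigwedge_{q\in B}\neg(0\le q)\wedge\bigwedge_{r\in C}\neg(0=r)$. Select a cube that has not been tried and compute $\langle Z',P'\rangle=\mathrm{saturate}(A)$. Reject the cube if $\mathrm{red}_{Z'}(1)=0$, or $\mathrm{red}_{Z'}(q)\in\mathrm{cone}(P')$ for some $q\in B$, or $\mathrm{red}_{Z'}(r)=0$ for some $r\in C$, and continue with the remaining cubes; otherwise return $\langle Z',P'\rangle$. If all cubes are rejected, $G$ is declared unsatisfiable. \end{itemize} \textbf{Procedure} $\mathrm{consequence}(F,X)$. Start with $G=F$ and $\langle Z,P\rangle=\langle\{1\},\{0\}\rangle$. While $G$ is satisfiable: let $\langle Z',P'\rangle$ be the result of $\mathrm{get\text{-}model}(G)$; replace $\langle Z',P'\rangle$ by $\mathrm{project}_X(Z',P')$; then replace $\langle Z,P\rangle$ by $\mathrm{intersect}(Z,P,Z',P')$; then replace $G$ by $G\wedge\neg\bigl(\bigwedge_{z\in Z}z=0\wedge\bigwedge_{p\in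 P}0\le p\bigr)$. Return $\langle Z,P\rangle$. \textbf{Theorem.} For every finite $Y$, every $X\subseteq Y$, every monomial ordering $\preceq$ and every ground formula $F$ over $Y$, the procedure $\mathrm{consequence}(F,X)$ terminates, and returns a pair $\langle Z,P\rangle$ of finite subsets of $\mathbb{Q}[X]$ that is reduced with respect to the restriction of $\preceq$ to the monomials over $X$ and satisfies $$\mathrm{alg.cone}_X(Z,P)=\mathbf{C}_X(F).$$ This holds for all choices of cubes, units $t$, Gröbner bases and elimination orders made by the procedure: no execution is infinite, and every execution that cannot be continued has returned such a pair. -/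

import Mathlib

/-! ### Linear real rings -/

/-- A model of the theory `LRR` of linear real rings: a non-trivial commutative ring with a partial
order that is compatible with addition, such that the additive group is divisible and
unperforated. -/
class LinearRealRing (A : Type*) extends CommRing A, PartialOrder A where
  compatibility : ∀ x y z : A, x ≤ y → x + z ≤ y + z
  zero_le_one' : (0 : A) ≤ 1
  zero_ne_one' : (0 : A) ≠ 1
  divisibility : ∀ n : ℕ, 1 ≤ n → ∃ x : A, n • x = 1
  perforation_free : ∀ n : ℕ, 1 ≤ n → ∀ x : A, 0 ≤ n • x → 0 ≤ x

namespace LinearRealRing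

variable (A : Type*) [LinearRealRing A]

theorem isUnit_intCast (y : nonZeroDivisors ℤ) : IsUnit (Int.castRingHom A (y : ℤ)) := by
  have hy : (y : ℤ) ≠ 0 := nonZeroDivisors.ne_zero y.2
  obtain ⟨x, hx⟩ := divisibility (A := A) (y : ℤ).natAbs (Int.natAbs_pos.mpr hy)
  have h : IsUnit (((y : ℤ).natAbs : ℕ) : A) :=
    IsUnit.of_mul_eq_one x (by rw [← hx, nsmul_eq_mul])
  rcases Int.natAbs_eq (y : ℤ) with h1 | h1
  · rw [h1]; simpa using h
  · rw [h1]; simpa using h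

/-- The (unique) interpretation of the rational numbers in a model of `LRR`. -/
noncomputable def ratHom : ℚ →+* A :=
  IsLocalization.lift (M := nonZeroDivisors ℤ) (g := Int.castRingHom A) (isUnit_intCast A)

variable {A}

/-- The value of a polynomial with rational coefficients in a model of `LRR`, given the
interpretation `v` of the constant symbols. -/
noncomputable def evalPoly {Y : Type*} (v : Y → A) (p : MvPolynomial Y ℚ) : A :=
  MvPolynomial.eval₂ (ratHom A) v p

end LinearRealRing

/-! ### Ground formulas over the ordered-ring signature with constant symbols `Y` -/

/-- Ground formulas, in the language whose atoms are `p ≤ q` and `p = q` for polynomials `p`, `q`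
with rational coefficients over the constant symbols `Y`. -/
inductive Formula (Y : Type*) where
  | tru : Formula Y
  | fls : Formula Y
  | le (p q : MvPolynomial Y ℚ) : Formula Y
  | eq (p q : MvPolynomial Y ℚ) : Formula Y
  | and (F G : Formula Y) : Formula Y
  | or (F G : Formula Y) : Formula Y
  | not (F : Formula Y) : Formula Y

namespace Formula

/-- Truth of a ground formula in a model of `LRR` whose constant symbols are interpreted by `v`. -/
def Holds {Y : Type*} {A : Type*} [LinearRealRing A] (v : Y → A) : Formula Y → Prop
  | tru => True
  | fls => False
  | le p q => LinearRealRing.evalPoly v p ≤ LinearRealRing.evalPoly v q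
  | eq p q => LinearRealRing.evalPoly v p = LinearRealRing.evalPoly v q
  | and F G => Holds v F ∧ Holds v G
  | or F G => Holds v F ∨ Holds v G
  | not F => ¬ Holds v F

universe u

/-- Entailment modulo `LRR`. -/
def Entails {Y : Type u} (F G : Formula Y) : Prop :=
  ∀ (A : Type u) [LinearRealRing A] (v : Y → A), F.Holds v → G.Holds v

/-- The consequence cone of `F` over `X`: the polynomials over `X` that `F` entails to be
non-negative modulo `LRR`. -/
def consequenceCone {Y : Type u} (F : Formula Y) (X : Set Y) : Set (MvPolynomial X ℚ) :=
  {p | F.Entails (le 0 (MvPolynomial.rename Subtype.val p))}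

/-- The conjunction of a list of formulas. -/
def conj {Y : Type*} : List (Formula Y) → Formula Y
  | [] => tru
  | F :: L => and F (conj L)

end Formula

/-- A cube (conjunctive formula): the conjunction of `0 ≤ p` for `p ∈ nonneg`, of `¬ (0 ≤ q)` for
`q ∈ notNonneg`, and of `¬ (0 = r)` for `r ∈ notZero`. -/
structure Cube (Y : Type*) where
  nonneg : List (MvPolynomial Y ℚ)
  notNonneg : List (MvPolynomial Y ℚ)
  notZero : List (MvPolynomial Y ℚ)

/-- The conjunction of two cubes. -/
def Cube.meet {Y : Type*} (c d : Cube Y) : Cube Y :=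
  ⟨c.nonneg ++ d.nonneg, c.notNonneg ++ d.notNonneg, c.notZero ++ d.notZero⟩

/-- The cubes of the disjunctive normal form of `F` (for `true`) and of `¬ F` (for `false`). Here
`p = q` is read as `0 ≤ p - q ∧ 0 ≤ q - p`, and its negation as `¬ (0 = p - q)`. -/
noncomputable def Formula.dnf {Y : Type*} : Bool → Formula Y → List (Cube Y)
  | true, tru => [⟨[], [], []⟩]
  | false, tru => []
  | true, fls => []
  | false, fls => [⟨[], [], []⟩]
  | true, le p q => [⟨[q - p], [], []⟩]
  | false, le p q => [⟨[], [q - p], []⟩]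
  | true, eq p q => [⟨[p - q, q - p], [], []⟩]
  | false, eq p q => [⟨[], [], [p - q]⟩]
  | true, and F G => (dnf true F).flatMap fun c => (dnf true G).map c.meet
  | false, and F G => dnf false F ++ dnf false G
  | true, or F G => dnf true F ++ dnf true G
  | false, or F G => (dnf false F).flatMap fun c => (dnf false G).map c.meet
  | true, not F => dnf false F
  | false, not F => dnf true F

/-! ### Monomial orderings -/

namespace MonomialOrder

/-- The monomial ordering obtained by comparing the images of monomials under an injective and
monotone additive map into a well-ordered additive monoid. -/
noncomputable def ofInjective {σ : Type*} {L : Type*} [AddCommMonoid L] [LinearOrder L]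
    [IsOrderedAddMonoid L] [WellFoundedLT L] (φ : (σ →₀ ℕ) →+ L)
    (hinj : Function.Injective φ) (hmono : Monotone φ) : MonomialOrder σ where
  syn := AddMonoidHom.mrange φ
  addCommMonoidSyn := AddSubmonoid.toAddCommMonoid _
  linearOrderSyn := Subtype.instLinearOrder _
  isOrderedAddMonoid_syn := AddSubmonoid.toIsOrderedAddMonoid _
  wellFoundedLT_syn := ⟨InvImage.wf Subtype.val (wellFounded_lt (α := L))⟩
  toSyn :=
    { Equiv.ofBijective φ.mrangeRestrict
        ⟨fun _ _ h => hinj (congrArg Subtype.val h), φ.mrangeRestrict_surjective⟩ with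
      map_add' := fun a b => Subtype.ext (φ.map_add a b) }
  toSyn_monotone := fun _ _ h => hmono h

/-- The restriction of a monomial ordering to the monomials over a subset of the variables. -/
noncomputable def restrict {σ : Type*} (m : MonomialOrder σ) (X : Set σ) : MonomialOrder X :=
  ofInjective
    (m.toSyn.toAddMonoidHom.comp
      (Finsupp.mapDomain.addMonoidHom (Subtype.val : X → σ)))
    (fun _ _ h => Finsupp.mapDomain_injective Subtype.val_injective (m.toSyn.injective h))
    (fun _ _ h => m.toSyn_monotone (Finsupp.mapDomain_mono h))

/-- An element of `α` and an element of `β` as a pair that is compared lexicographically. -/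
def lexHom {M α β : Type*} [AddCommMonoid M] [AddCommMonoid α] [AddCommMonoid β]
    (f : M →+ α) (g : M →+ β) : M →+ α ×ₗ β where
  toFun x := toLex (f x, g x)
  map_zero' := by simp
  map_add' x y := by simp only [map_add]; rfl

theorem lexHom_monotone {M α β : Type*} [AddCommMonoid M] [AddCommMonoid α] [AddCommMonoid β]
    [Preorder M] [LinearOrder α] [LinearOrder β] (f : M →+ α) (g : M →+ β)
    (hf : Monotone f) (hg : Monotone g) : Monotone (lexHom f g) :=
  fun _ _ h => Prod.Lex.toLex_mono ⟨hf h, hg h⟩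

open scoped Classical in
/-- The elimination ordering that favours the variables in `X`: monomials are compared by `m` on
their parts outside `X` first, and then by `m` on their parts over `X`. -/
noncomputable def elimination {σ : Type*} (m : MonomialOrder σ) (X : Set σ) : MonomialOrder σ :=
  ofInjective
    (lexHom (m.toSyn.toAddMonoidHom.comp (Finsupp.filterAddHom (fun x => x ∉ X)))
      (m.toSyn.toAddMonoidHom.comp (Finsupp.filterAddHom (fun x => x ∈ X))))
    (fun a b h => by
      have h' := congrArg ofLex h
      have h1 := m.toSyn.injective (congrArg Prod.fst h')
      have h2 := m.toSyn.injective (congrArg Prod.snd h')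
      ext x
      by_cases hx : x ∈ X
      · have := DFunLike.congr_fun h2 x
        simpa [Finsupp.filterAddHom, Finsupp.filter_apply, hx] using this
      · have := DFunLike.congr_fun h1 x
        simpa [Finsupp.filterAddHom, Finsupp.filter_apply, hx] using this)
    (lexHom_monotone _ _
      (fun a b h => m.toSyn_monotone (fun x => by
        by_cases hx : x ∈ X <;> simp [Finsupp.filterAddHom, hx, h x]))
      (fun a b h => m.toSyn_monotone (fun x => by
        by_cases hx : x ∈ X <;> simp [Finsupp.filterAddHom, hx, h x])))

/-- The elimination ordering for one extra variable `none`: monomials are compared by their degree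
in `none` first, and then by `m` on the remaining variables. -/
noncomputable def tag {σ : Type*} (m : MonomialOrder σ) : MonomialOrder (Option σ) :=
  ofInjective
    (lexHom (Finsupp.applyAddHom none)
      (m.toSyn.toAddMonoidHom.comp
        { toFun := Finsupp.some, map_zero' := Finsupp.some_zero, map_add' := Finsupp.some_add }))
    (fun a b h => by
      have h' := congrArg ofLex h
      have h1 : a none = b none := congrArg Prod.fst h'
      have h2 : a.some = b.some := m.toSyn.injective (congrArg Prod.snd h')
      ext x
      cases x with
      | none => exact h1
      | some x => exact DFunLike.congr_fun h2 x)
    (lexHom_monotone _ _ (fun a b h => Finsupp.le_def.mp h none)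
      (fun a b h => m.toSyn_monotone (fun x => Finsupp.le_def.mp h (some x))))

end MonomialOrder

/-! ### Algebraic cones and reduced pairs -/

namespace AlgCone

open MvPolynomial

variable {σ τ : Type*}

/-- The cone `ℚ≥0 · P` generated by a finite set of polynomials. -/
noncomputable def cone (P : Finset (MvPolynomial σ ℚ)) : PointedCone ℚ (MvPolynomial σ ℚ) :=
  PointedCone.hull ℚ (P : Set (MvPolynomial σ ℚ))

/-- The ideal `⟨Z⟩` generated by a finite set of polynomials. -/
noncomputable def ideal (Z : Finset (MvPolynomial σ ℚ)) : Ideal (MvPolynomial σ ℚ) :=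
  Ideal.span (Z : Set (MvPolynomial σ ℚ))

/-- The algebraic cone `⟨Z⟩ + cone(P)`. -/
def algCone (Z P : Finset (MvPolynomial σ ℚ)) : Set (MvPolynomial σ ℚ) :=
  {f | ∃ z ∈ ideal Z, ∃ p ∈ cone P, f = z + p}

/-- `G` is a Gröbner basis of the ideal `I`: its elements are non-zero and generate `I`, and the
leading monomial of each non-zero element of `I` is divisible by that of some element of `G`. -/
def IsGroebnerBasis (m : MonomialOrder σ) (G : Finset (MvPolynomial σ ℚ))
    (I : Ideal (MvPolynomial σ ℚ)) : Prop :=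
  0 ∉ G ∧ ideal G = I ∧ ∀ f ∈ I, f ≠ 0 → ∃ g ∈ G, m.degree g ≤ m.degree f

/-- `q = red_G(p)`: `p - q ∈ ⟨G⟩`, and no monomial of `q` is divisible by the leading monomial of
an element of `G`. -/
def IsNormalForm (m : MonomialOrder σ) (G : Finset (MvPolynomial σ ℚ))
    (p q : MvPolynomial σ ℚ) : Prop :=
  p - q ∈ ideal G ∧ ∀ a ∈ q.support, ∀ g ∈ G, ¬ m.degree g ≤ a

/-- The pair `⟨Z, P⟩` is reduced with respect to `m`: `Z` is a Gröbner basis of `⟨Z⟩`, and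
`red_Z(p) = p` for each `p ∈ P`. -/
def IsReducedPair (m : MonomialOrder σ) (Z P : Finset (MvPolynomial σ ℚ)) : Prop :=
  IsGroebnerBasis m Z (ideal Z) ∧ ∀ p ∈ P, IsNormalForm m Z p p

/-! ### The subroutines

Gröbner bases are not unique, so the subroutines are relations between inputs and possible
outputs. -/

/-- `⟨Z', P'⟩` is a result of `reduce(Z, P)`: `Z'` is a Gröbner basis of `⟨Z⟩`, and `P'` consists of
the non-zero `red_{Z'}(p)`, `p ∈ P`. -/
def Reduce (m : MonomialOrder σ) (Z P Z' P' : Finset (MvPolynomial σ ℚ)) : Prop :=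
  IsGroebnerBasis m Z' (ideal Z) ∧ ∀ q, q ∈ P' ↔ q ≠ 0 ∧ ∃ p ∈ P, IsNormalForm m Z' p q

open scoped Classical in
/-- One step of Fourier-Motzkin elimination, eliminating the monomial `a`: keep the polynomials in
which `a` does not occur, and add up those with coefficients `1` and `-1` after normalization. -/
noncomputable def fmStep (P : Finset (MvPolynomial σ ℚ)) (a : σ →₀ ℕ) :
    Finset (MvPolynomial σ ℚ) :=
  P.filter (fun p => coeff a p = 0) ∪
    Finset.image₂ (fun p q => (coeff a p)⁻¹ • p + (-coeff a q)⁻¹ • q)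
      (P.filter (fun p => 0 < coeff a p)) (P.filter (fun q => coeff a q < 0))

/-- `P'` is a result of Fourier-Motzkin elimination applied to `P`: the monomials that occur in `P`
but not in `N` are eliminated one at a time, in some order. -/
def PolyhedralProject (N : Set (σ →₀ ℕ)) (P P' : Finset (MvPolynomial σ ℚ)) : Prop :=
  ∃ l : List (σ →₀ ℕ), l.Nodup ∧ (∀ a, a ∈ l ↔ a ∉ N ∧ ∃ p ∈ P, a ∈ p.support) ∧
    P' = l.foldl fmStep P

/-- `⟨Z', P'⟩` is a result of projecting `⟨Z, P⟩` from the variables `τ` to the variables `σ`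
(included by `ι`), where `m` is an elimination ordering: for some Gröbner basis `G` of `⟨Z⟩`, `Z'`
is the part of `G` over `σ`, and `P'` is the result of eliminating from `{red_G(p) | p ∈ P}` the
monomials that are not over `σ`. -/
def Project (m : MonomialOrder τ) (ι : σ → τ) (Z P : Finset (MvPolynomial τ ℚ))
    (Z' P' : Finset (MvPolynomial σ ℚ)) : Prop :=
  ∃ G R Q : Finset (MvPolynomial τ ℚ), IsGroebnerBasis m G (ideal Z) ∧
    (∀ q, q ∈ R ↔ ∃ p ∈ P, IsNormalForm m G p q) ∧
    PolyhedralProject (Set.range (Finsupp.mapDomain ι)) R Q ∧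
    (∀ z, z ∈ Z' ↔ rename ι z ∈ G) ∧ (∀ p, p ∈ P' ↔ rename ι p ∈ Q)

open scoped Classical in
/-- The set `{f · p | p ∈ P}`, with the variables included among those with one more variable. -/
noncomputable def tagWith (f : MvPolynomial (Option σ) ℚ) (P : Finset (MvPolynomial σ ℚ)) :
    Finset (MvPolynomial (Option σ) ℚ) :=
  P.image fun p => f * rename some p

open scoped Classical in
/-- `⟨Z, P⟩` is a result of `intersect(Z₁, P₁, Z₂, P₂)`: the projection of
`⟨t Z₁ ∪ (1 - t) Z₂, t P₁ ∪ (1 - t) P₂⟩` to the variables other than `t`, where `t` is a new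
variable. -/
def Intersect (m : MonomialOrder σ) (Z₁ P₁ Z₂ P₂ Z P : Finset (MvPolynomial σ ℚ)) : Prop :=
  Project m.tag some
    (tagWith (X none) Z₁ ∪ tagWith (1 - X none) Z₂)
    (tagWith (X none) P₁ ∪ tagWith (1 - X none) P₂) Z P

/-- The test of the theory solver: for the saturation `⟨Z, P⟩` of the non-negative atoms of the
cube `c`, the cube is found to be unsatisfiable. -/
def Refutes (m : MonomialOrder σ) (c : Cube σ) (Z P : Finset (MvPolynomial σ ℚ)) : Prop :=
  IsNormalForm m Z 1 0 ∨
    (∃ q ∈ c.notNonneg, ∃ q', IsNormalForm m Z q q' ∧ q' ∈ cone P) ∨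
    ∃ r ∈ c.notZero, IsNormalForm m Z r 0

/-- `t` is a non-zero additive unit of `cone(P)`. -/
def IsNonzeroUnit (P : Finset (MvPolynomial σ ℚ)) (t : MvPolynomial σ ℚ) : Prop :=
  t ≠ 0 ∧ t ∈ cone P ∧ -t ∈ cone P

end AlgCone

/-! ### The lazy consequence-finding procedure -/

namespace LazyConsequence

open AlgCone MvPolynomial

/-- Configurations of the procedure. -/
inductive State {Y : Type*} (X : Set Y) where
  /-- Searching for a satisfiable cube of `G` among the remaining cubes `L`; the current pair is
  `⟨Z, P⟩`. -/
  | search (G : Formula Y) (Z P : Finset (MvPolynomial X ℚ)) (L : List (Cube Y)) : State X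
  /-- Running the saturation loop for the selected cube `c`, with current pair `⟨Z', P'⟩`. -/
  | saturate (G : Formula Y) (Z P : Finset (MvPolynomial X ℚ)) (L : List (Cube Y)) (c : Cube Y)
      (Z' P' : Finset (MvPolynomial Y ℚ)) : State X
  /-- The procedure has returned `⟨Z, P⟩`. -/
  | done (Z P : Finset (MvPolynomial X ℚ)) : State X

variable {Y : Type*} {X : Set Y}

/-- The head of the main loop, for the formula `G` and the pair `⟨Z, P⟩`: all the cubes of the
disjunctive normal form of `G` are yet to be tried. -/
noncomputable def loopHead (G : Formula Y) (Z P : Finset (MvPolynomial X ℚ)) : State X :=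
  State.search G Z P (Formula.dnf true G)

/-- The initial configuration: `G = F` and `⟨Z, P⟩ = ⟨{1}, {0}⟩`. -/
noncomputable def init (F : Formula Y) (X : Set Y) : State X :=
  loopHead F {1} {0}

/-- The blocking clause `⋀ z = 0 ∧ ⋀ 0 ≤ p`, over `z ∈ Z` and `p ∈ P`, before negation. -/
noncomputable def blocked (Z P : Finset (MvPolynomial X ℚ)) : Formula Y :=
  Formula.and
    (Formula.conj (Z.toList.map fun z => Formula.eq (rename Subtype.val z) 0))
    (Formula.conj (P.toList.map fun p => Formula.le 0 (rename Subtype.val p)))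

open scoped Classical in
/-- One step of the procedure `consequence(F, X)`, with respect to the monomial ordering `m`. -/
inductive Step (m : MonomialOrder Y) : State X → State X → Prop
  /-- `G` has been found to be unsatisfiable: leave the main loop. -/
  | exit (G : Formula Y) (Z P : Finset (MvPolynomial X ℚ)) :
      Step m (State.search G Z P []) (State.done Z P)
  /-- Select some remaining cube, and start to saturate its non-negative atoms. -/
  | select (G : Formula Y) (Z P : Finset (MvPolynomial X ℚ)) (L₁ L₂ : List (Cube Y)) (c : Cube Y) :
      Step m (State.search G Z P (L₁ ++ c :: L₂))
        (State.saturate G Z P (L₁ ++ L₂) c ∅ (insert 1 c.nonneg.toFinset))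
  /-- An iteration of the saturation loop: turn a non-zero additive unit into a zero. -/
  | unit (G : Formula Y) (Z P : Finset (MvPolynomial X ℚ)) (L : List (Cube Y)) (c : Cube Y)
      (Z' P' Z'' P'' : Finset (MvPolynomial Y ℚ)) (t : MvPolynomial Y ℚ)
      (ht : IsNonzeroUnit P' t) (hr : Reduce m (insert t Z') P' Z'' P'') :
      Step m (State.saturate G Z P L c Z' P') (State.saturate G Z P L c Z'' P'')
  /-- The saturation is complete and the cube is unsatisfiable: try the other cubes. -/
  | reject (G : Formula Y) (Z P : Finset (MvPolynomial X ℚ)) (L : List (Cube Y)) (c : Cube Y)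
      (Z' P' : Finset (MvPolynomial Y ℚ)) (hs : ∀ t, ¬ IsNonzeroUnit P' t)
      (hc : Refutes m c Z' P') :
      Step m (State.saturate G Z P L c Z' P') (State.search G Z P L)
  /-- The saturation is complete and the cube is satisfiable, so that `⟨Z', P'⟩` is the model:
  project it, intersect, and add the blocking clause. -/
  | accept (G : Formula Y) (Z P : Finset (MvPolynomial X ℚ)) (L : List (Cube Y)) (c : Cube Y)
      (Z' P' : Finset (MvPolynomial Y ℚ)) (Z₁ P₁ Z₂ P₂ : Finset (MvPolynomial X ℚ))
      (hs : ∀ t, ¬ IsNonzeroUnit P' t) (hc : ¬ Refutes m c Z' P')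
      (hp : Project (m.elimination X) Subtype.val Z' P' Z₁ P₁)
      (hi : Intersect (m.restrict X) Z P Z₁ P₁ Z₂ P₂) :
      Step m (State.saturate G Z P L c Z' P')
        (loopHead (Formula.and G (Formula.not (blocked Z₂ P₂))) Z₂ P₂)

end LazyConsequence

/-! Linear real rings do not ask products of non-negative elements to be non-negative, so their
models can be built directly from cones. If ⟨Z, P⟩ is reduced, every element of cone(P) is
irreducible modulo Z. If in addition cone(P) has no non-zero unit, then f and -f both lie in ⟨Z⟩ +
cone(P) only for f ∈ ⟨Z⟩ (`IsReducedPair.mem_ideal_of_units`). When 1 lies in this algebraic cone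
but not in ⟨Z⟩, the quotient ℚ[Y]/⟨Z⟩, ordered by the image of the cone, is therefore a model whose
non-negative polynomials are exactly ⟨Z⟩ + cone(P) (`exists_nonnegCone_eq`). Saturation only adds
consequences of the positive literals, so a cube that is not refuted has a model realising precisely
those consequences.

Projection computes the intersection with ℚ[X] (`Project.mem_algHull_iff`), and
`Intersect.mem_algHull_iff` intersects two algebraic cones. The model of an accepted cube satisfies
F, so the current cone always contains the consequence cone. Conversely, G says that F holds and
that some element of the current cone is not non-negative; once G is unsatisfiable, the two cones
agree.

Saturation terminates because ⟨Z⟩ grows strictly in a Noetherian ring. The main loop terminates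
because a negated blocking clause has only negative literals: the positive parts of the cubes of G
all come from the finitely many cubes of F. Accepting a cube makes its positive part entail the
whole current cone, which it did not do before, and later cones are smaller
(`LoopInvariant.accept`). -/

open MvPolynomial

namespace AlgCone

/-! ### Normal forms and existence of Gröbner bases. -/

section NormalForm

variable {σ : Type*} {m : MonomialOrder σ} {G : Finset (MvPolynomial σ ℚ)}

/-- The polynomials none of whose monomials is divisible by a leading monomial of an element
of `G`. -/
def irreducibles (m : MonomialOrder σ) (G : Finset (MvPolynomial σ ℚ)) :
    Submodule ℚ (MvPolynomial σ ℚ) where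
  carrier := {q | ∀ a ∈ q.support, ∀ g ∈ G, ¬ m.degree g ≤ a}
  zero_mem' := by simp
  add_mem' := by
    classical
    intro p q hp hq a ha
    rcases Finset.mem_union.mp (support_add ha) with h | h
    exacts [hp a h, hq a h]
  smul_mem' c p hp a ha := hp a (support_smul ha)

theorem isNormalForm_iff {p q : MvPolynomial σ ℚ} :
    IsNormalForm m G p q ↔ p - q ∈ ideal G ∧ q ∈ irreducibles m G := Iff.rfl

theorem IsGroebnerBasis.eq_zero_of_mem_irreducibles {I : Ideal (MvPolynomial σ ℚ)}
    (hG : IsGroebnerBasis m G I) {f : MvPolynomial σ ℚ} (hf : f ∈ I)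
    (hf' : f ∈ irreducibles m G) : f = 0 := by
  by_contra h0
  obtain ⟨g, hg, hgf⟩ := hG.2.2 f hf h0
  exact hf' _ (m.degree_mem_support h0) g hg hgf

theorem IsGroebnerBasis.self {I : Ideal (MvPolynomial σ ℚ)} (hG : IsGroebnerBasis m G I) :
    IsGroebnerBasis m G (ideal G) := by
  have h := hG
  rwa [← hG.2.1] at h

theorem IsGroebnerBasis.eq_of_sub_mem {I : Ideal (MvPolynomial σ ℚ)}
    (hG : IsGroebnerBasis m G I) {p q : MvPolynomial σ ℚ} (hp : p ∈ irreducibles m G)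
    (hq : q ∈ irreducibles m G) (h : p - q ∈ ideal G) : p = q :=
  sub_eq_zero.mp (hG.self.eq_zero_of_mem_irreducibles h (sub_mem hp hq))

theorem IsGroebnerBasis.isNormalForm_unique {I : Ideal (MvPolynomial σ ℚ)}
    (hG : IsGroebnerBasis m G I) {p q q' : MvPolynomial σ ℚ}
    (h : IsNormalForm m G p q) (h' : IsNormalForm m G p q') : q = q' :=
  hG.eq_of_sub_mem h.2 h'.2 (by simpa using sub_mem h'.1 h.1)

theorem exists_isNormalForm (h0 : 0 ∉ G) (p : MvPolynomial σ ℚ) :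
    ∃ q, IsNormalForm m G p q := by
  obtain ⟨g, r, hr, -, hirr⟩ := m.div_set (B := (G : Set (MvPolynomial σ ℚ)))
    (fun b hb => isUnit_iff_ne_zero.mpr
      (m.leadingCoeff_ne_zero_iff.mpr (fun h => h0 (h ▸ hb)))) p
  refine ⟨r, ?_, hirr⟩
  rw [hr, add_sub_cancel_right, Finsupp.linearCombination_apply]
  exact sum_mem fun i _ => Ideal.mul_mem_left _ _ (Ideal.subset_span i.2)

/-- By Dickson's lemma, the leading monomials of the ideal have finitely many minimal elements; one
polynomial is picked for each. These generate the ideal because the remainder of a division lies in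
it and is irreducible, hence is zero. -/
theorem exists_isGroebnerBasis [Finite σ] (m : MonomialOrder σ) (I : Ideal (MvPolynomial σ ℚ)) :
    ∃ G, IsGroebnerBasis m G I := by
  classical
  set S : Set (σ →₀ ℕ) := {a | ∃ f ∈ I, f ≠ 0 ∧ m.degree f = a} with hS
  have hpwo : S.IsPWO := Set.isPWO_of_wellQuasiOrderedLE S
  have hfin : {a | Minimal (· ∈ S) a}.Finite :=
    WellQuasiOrderedLE.finite_of_isAntichain (setOfPred_minimal_antichain _)
  choose! f hfI hf0 hfd using fun a (ha : a ∈ S) => ha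
  have hmin : ∀ p ∈ I, p ≠ 0 → ∃ g ∈ hfin.toFinset.image f, m.degree g ≤ m.degree p := by
    intro p hp hp0
    obtain ⟨b, hb, hbmin⟩ := hpwo.exists_le_minimal (⟨p, hp, hp0, rfl⟩ : m.degree p ∈ S)
    exact ⟨f b, Finset.mem_image_of_mem _ (hfin.mem_toFinset.mpr hbmin), by
      rwa [hfd b hbmin.1]⟩
  have hmem : ∀ g ∈ hfin.toFinset.image f, g ∈ I ∧ g ≠ 0 := by
    intro g hg
    obtain ⟨a, ha, rfl⟩ := Finset.mem_image.mp hg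
    have ha' := (hfin.mem_toFinset.mp ha).1
    exact ⟨hfI a ha', hf0 a ha'⟩
  have h0 : 0 ∉ hfin.toFinset.image f := fun h => (hmem 0 h).2 rfl
  have hle : ideal (hfin.toFinset.image f) ≤ I := Ideal.span_le.mpr fun g hg => (hmem g hg).1
  refine ⟨hfin.toFinset.image f, h0, le_antisymm hle fun p hp => ?_, hmin⟩
  obtain ⟨q, hq, hirr⟩ := exists_isNormalForm (m := m) h0 p
  have hqI : q ∈ I := by simpa using sub_mem hp (hle hq)
  by_cases hq0 : q = 0
  · simpa [hq0] using hq
  · obtain ⟨g, hg, hgq⟩ := hmin q hqI hq0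
    exact absurd hgq (hirr _ (m.degree_mem_support hq0) g hg)

open scoped Classical in
theorem exists_finset_isNormalForm (hG : IsGroebnerBasis m G (ideal G))
    (P : Finset (MvPolynomial σ ℚ)) :
    ∃ R : Finset (MvPolynomial σ ℚ), ∀ q, q ∈ R ↔ ∃ p ∈ P, IsNormalForm m G p q := by
  choose nf hnf using exists_isNormalForm (m := m) hG.1
  refine ⟨P.image nf, fun q => Finset.mem_image.trans ?_⟩
  exact ⟨fun ⟨p, hp, h⟩ => ⟨p, hp, h ▸ hnf p⟩,
    fun ⟨p, hp, h⟩ => ⟨p, hp, hG.isNormalForm_unique (hnf p) h⟩⟩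

open scoped Classical in
theorem exists_reduce [Finite σ] (m : MonomialOrder σ) (Z P : Finset (MvPolynomial σ ℚ)) :
    ∃ Z' P', Reduce m Z P Z' P' := by
  obtain ⟨G, hG⟩ := exists_isGroebnerBasis m (ideal Z)
  obtain ⟨R, hR⟩ := exists_finset_isNormalForm hG.self P
  exact ⟨G, R.erase 0, hG, fun q => by rw [Finset.mem_erase, hR]⟩

end NormalForm

/-! ### Algebraic cones of reduced pairs. -/

section Hull

variable {σ : Type*} {Z P : Finset (MvPolynomial σ ℚ)}

/-- The algebraic cone `⟨Z⟩ + cone(P)` as a pointed cone. -/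
noncomputable def algHull (Z P : Finset (MvPolynomial σ ℚ)) :
    PointedCone ℚ (MvPolynomial σ ℚ) where
  carrier := algCone Z P
  zero_mem' := ⟨0, zero_mem _, 0, zero_mem _, by simp⟩
  add_mem' := by
    rintro _ _ ⟨z, hz, p, hp, rfl⟩ ⟨z', hz', p', hp', rfl⟩
    exact ⟨z + z', add_mem hz hz', p + p', add_mem hp hp', by abel⟩
  smul_mem' := by
    rintro c _ ⟨z, hz, p, hp, rfl⟩
    refine ⟨c • z, ?_, c • p, Submodule.smul_mem _ c hp, smul_add _ _ _⟩
    exact Submodule.smul_of_tower_mem (ideal Z) (c : ℚ) hz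

theorem mem_algHull_of_mem_ideal {f : MvPolynomial σ ℚ} (h : f ∈ ideal Z) : f ∈ algHull Z P :=
  ⟨f, h, 0, zero_mem _, by simp⟩

theorem mem_algHull_of_mem_cone {f : MvPolynomial σ ℚ} (h : f ∈ cone P) : f ∈ algHull Z P :=
  ⟨0, zero_mem _, f, h, by simp⟩

theorem mem_cone_of_mem {f : MvPolynomial σ ℚ} (h : f ∈ P) : f ∈ cone P :=
  Submodule.subset_span h

theorem algHull_le {D : PointedCone ℚ (MvPolynomial σ ℚ)} (hZ : ∀ f ∈ ideal Z, f ∈ D)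
    (hP : ∀ p ∈ P, p ∈ D) : algHull Z P ≤ D := by
  rintro _ ⟨z, hz, p, hp, rfl⟩
  exact add_mem (hZ z hz) ((Submodule.span_le (p := D)).mpr hP hp)

theorem smul_mem_cone {C : PointedCone ℚ (MvPolynomial σ ℚ)} {c : ℚ} (hc : 0 ≤ c)
    {f : MvPolynomial σ ℚ} (hf : f ∈ C) : c • f ∈ C :=
  Submodule.smul_mem C ⟨c, hc⟩ hf

/-- Transfers linear conditions, such as irreducibility or the vanishing of a coefficient, from the
generators to the cone. -/
theorem cone_le_of_subset_submodule {W : Submodule ℚ (MvPolynomial σ ℚ)} (h : ∀ p ∈ P, p ∈ W)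
    {f : MvPolynomial σ ℚ} (hf : f ∈ cone P) : f ∈ W :=
  (Submodule.span_le (p := (W.restrictScalars {c : ℚ // 0 ≤ c}))).mpr h hf

variable {m : MonomialOrder σ}

/-- A polynomial and its normal form differ by an element of the ideal. Only non-zero normal forms
are required in `R`, which covers both `Reduce`, where 0 is dropped, and `Project`, where it is
kept. -/
theorem algHull_normalForm {G R : Finset (MvPolynomial σ ℚ)}
    (hG : IsGroebnerBasis m G (ideal Z))
    (h1 : ∀ q ∈ R, ∃ p ∈ P, IsNormalForm m G p q)
    (h2 : ∀ p ∈ P, ∀ q, IsNormalForm m G p q → q ≠ 0 → q ∈ R) :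
    algHull G R = algHull Z P := by
  refine le_antisymm (algHull_le ?_ ?_) (algHull_le ?_ ?_)
  · exact fun f hf => mem_algHull_of_mem_ideal (hG.2.1 ▸ hf)
  · intro q hq
    obtain ⟨p, hp, hpq⟩ := h1 q hq
    have := add_mem (mem_algHull_of_mem_ideal (P := P) (Z := Z) (hG.2.1 ▸ neg_mem hpq.1))
      (mem_algHull_of_mem_cone (mem_cone_of_mem hp))
    simpa using this
  · exact fun f hf => mem_algHull_of_mem_ideal (hG.2.1.symm ▸ hf)
  · intro p hp
    obtain ⟨q, hq⟩ := exists_isNormalForm (m := m) hG.1 p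
    by_cases hq0 : q = 0
    · exact mem_algHull_of_mem_ideal (by simpa [hq0] using hq.1)
    · have := add_mem (mem_algHull_of_mem_ideal (P := R) (Z := G) hq.1)
        (mem_algHull_of_mem_cone (mem_cone_of_mem (h2 p hp q hq hq0)))
      simpa using this

theorem Reduce.algHull_eq {Z' P' : Finset (MvPolynomial σ ℚ)} (h : Reduce m Z P Z' P') :
    algHull Z' P' = algHull Z P :=
  algHull_normalForm h.1 (fun q hq => ((h.2 q).mp hq).2)
    (fun p hp q hpq hq0 => (h.2 q).mpr ⟨hq0, p, hp, hpq⟩)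

theorem IsNormalForm.self {G : Finset (MvPolynomial σ ℚ)} {p q : MvPolynomial σ ℚ}
    (h : IsNormalForm m G p q) : IsNormalForm m G q q :=
  ⟨by simp, h.2⟩

theorem Reduce.isReducedPair {Z' P' : Finset (MvPolynomial σ ℚ)} (h : Reduce m Z P Z' P') :
    IsReducedPair m Z' P' := by
  refine ⟨h.1.self, fun q hq => ?_⟩
  obtain ⟨p, -, hpq⟩ := ((h.2 q).mp hq).2
  exact hpq.self

theorem IsReducedPair.mem_irreducibles (h : IsReducedPair m Z P) {f : MvPolynomial σ ℚ}
    (hf : f ∈ cone P) : f ∈ irreducibles m Z :=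
  cone_le_of_subset_submodule (W := irreducibles m Z) (fun p hp => (h.2 p hp).2) hf

/-- For f = z + p and -f = z' + p', the sum p + p' lies in the ideal and is irreducible, so it
vanishes. Then p is a unit of the cone, hence zero. -/
theorem IsReducedPair.mem_ideal_of_units (h : IsReducedPair m Z P)
    (hs : ∀ t, ¬ IsNonzeroUnit P t) {f : MvPolynomial σ ℚ} (hf : f ∈ algHull Z P)
    (hf' : -f ∈ algHull Z P) : f ∈ ideal Z := by
  obtain ⟨z, hz, p, hp, rfl⟩ := hf
  obtain ⟨z', hz', p', hp', h'⟩ := hf'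
  have hpp : p + p' = 0 := by
    refine h.1.eq_zero_of_mem_irreducibles ?_
      (add_mem (h.mem_irreducibles hp) (h.mem_irreducibles hp'))
    have e : p + p' = -(z + z') := by linear_combination -h'
    exact e ▸ neg_mem (add_mem hz hz')
  have hp0 : p = 0 := by
    by_contra h0
    exact hs p ⟨h0, hp, by rwa [neg_eq_of_add_eq_zero_right hpp]⟩
  simpa [hp0] using hz

end Hull

end AlgCone

namespace AlgCone

/-! ### Fourier–Motzkin elimination. -/

section FourierMotzkin

variable {σ : Type*} {P : Finset (MvPolynomial σ ℚ)}

theorem hull_le_comap {τ : Type*} {S : Set (MvPolynomial σ ℚ)}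
    {D : PointedCone ℚ (MvPolynomial τ ℚ)} (L : MvPolynomial σ ℚ →ₗ[ℚ] MvPolynomial τ ℚ)
    (h : ∀ p ∈ S, L p ∈ D) {f : MvPolynomial σ ℚ} (hf : f ∈ PointedCone.hull ℚ S) : L f ∈ D :=
  (Submodule.span_le (p := PointedCone.comap L D)).mpr h hf

theorem sum_eq_sum_filter_sign {E ι : Type*} [AddCommMonoid E] (s : Finset ι) (c : ι → ℚ)
    (f : ι → E) :
    ∑ i ∈ s, f i = ∑ i ∈ s with c i = 0, f i + ∑ i ∈ s with 0 < c i, f i +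
      ∑ i ∈ s with c i < 0, f i := by
  rw [Finset.sum_filter, Finset.sum_filter, Finset.sum_filter, ← Finset.sum_add_distrib,
    ← Finset.sum_add_distrib]
  refine Finset.sum_congr rfl fun i _ => ?_
  rcases lt_trichotomy (c i) 0 with h | h | h
  · simp [h, h.ne, h.not_gt]
  · simp [h]
  · simp [h, h.ne', h.not_gt]

theorem mem_cone_fmStep {a : σ →₀ ℕ} {f : MvPolynomial σ ℚ} :
    f ∈ cone (fmStep P a) ↔ f ∈ cone P ∧ coeff a f = 0 := by
  classical
  constructor
  · intro hf
    have key : ∀ p ∈ fmStep P a, p ∈ cone P ∧ coeff a p = 0 := by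
      intro p hp
      rw [fmStep, Finset.mem_union] at hp
      rcases hp with hp | hp
      · exact ⟨mem_cone_of_mem (Finset.mem_filter.mp hp).1, (Finset.mem_filter.mp hp).2⟩
      · obtain ⟨p', hp', q, hq, rfl⟩ := Finset.mem_image₂.mp hp
        obtain ⟨hp', hpc⟩ := Finset.mem_filter.mp hp'
        obtain ⟨hq, hqc⟩ := Finset.mem_filter.mp hq
        refine ⟨add_mem (smul_mem_cone (inv_nonneg.mpr hpc.le) (mem_cone_of_mem hp'))
          (smul_mem_cone (inv_nonneg.mpr (by linarith)) (mem_cone_of_mem hq)), ?_⟩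
        rw [coeff_add, coeff_smul, coeff_smul, smul_eq_mul, smul_eq_mul, inv_mul_cancel₀ hpc.ne',
          inv_neg, neg_mul, inv_mul_cancel₀ hqc.ne, add_neg_cancel]
    exact ⟨hull_le_comap LinearMap.id (fun p hp => (key p hp).1) hf,
      cone_le_of_subset_submodule (W := LinearMap.ker (lcoeff ℚ a)) (fun p hp => (key p hp).2) hf⟩
  · rintro ⟨hf, hfa⟩
    obtain ⟨w, -, hw⟩ := Submodule.mem_span_finset.mp hf
    set l : MvPolynomial σ ℚ → ℚ := fun p => (w p : ℚ) with hl
    have hl0 : ∀ p, 0 ≤ l p := fun p => (w p).2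
    have hw' : ∑ p ∈ P, l p • p = f := hw
    set c : MvPolynomial σ ℚ → ℚ := fun p => coeff a p with hc
    have hsum : ∑ p ∈ P, l p * c p = 0 := by
      rw [← hfa, ← hw', coeff_sum]
      simp [hc]
    -- As the coefficient of `a` in `f` vanishes, `S` is both the total positive contribution to it
    -- and the absolute value of the total negative one.
    set S := ∑ p ∈ P with 0 < c p, l p * c p with hS
    have hS' : ∑ q ∈ P with c q < 0, l q * -c q = S := by
      rw [sum_eq_sum_filter_sign P c, Finset.sum_eq_zero (s := P.filter (c · = 0))
        (fun p hp => by rw [(Finset.mem_filter.mp hp).2, mul_zero]), zero_add] at hsum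
      simp only [mul_neg, Finset.sum_neg_distrib]
      linarith
    have hzero : ∑ p ∈ P with c p = 0, l p • p ∈ cone (fmStep P a) :=
      sum_mem fun p hp => smul_mem_cone (hl0 p)
        (mem_cone_of_mem (Finset.mem_union_left _ hp))
    have hpos : ∀ p ∈ P.filter (0 < c ·), 0 ≤ l p * c p := fun p hp =>
      mul_nonneg (hl0 p) (Finset.mem_filter.mp hp).2.le
    have hneg : ∀ p ∈ P.filter (c · < 0), 0 ≤ l p * -c p := fun p hp =>
      mul_nonneg (hl0 p) (by linarith [(Finset.mem_filter.mp hp).2])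
    rw [← hw', sum_eq_sum_filter_sign P c]
    have hS0 : 0 ≤ S := Finset.sum_nonneg hpos
    -- If `S = 0`, no generator containing `a` is used. Otherwise each positive generator is matched
    -- with each negative one, weighted by the product of their contributions; the result is `S`
    -- times the required sum.
    rcases hS0.eq_or_lt with h0 | h0
    · have e1 : ∑ p ∈ P with 0 < c p, l p • p = 0 := Finset.sum_eq_zero fun p hp => by
        have h1 := (Finset.sum_eq_zero_iff_of_nonneg hpos).mp (hS.symm.trans h0.symm) p hp
        rw [(mul_eq_zero.mp h1).resolve_right (Finset.mem_filter.mp hp).2.ne', zero_smul]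
      have e2 : ∑ p ∈ P with c p < 0, l p • p = 0 := Finset.sum_eq_zero fun p hp => by
        have h1 := (Finset.sum_eq_zero_iff_of_nonneg hneg).mp (hS'.trans h0.symm) p hp
        rw [(mul_eq_zero.mp h1).resolve_right
          (neg_ne_zero.mpr (Finset.mem_filter.mp hp).2.ne), zero_smul]
      rw [e1, e2, add_zero, add_zero]
      exact hzero
    · have hpair : ∑ p ∈ P with 0 < c p, ∑ q ∈ P with c q < 0,
          ((l p * c p) * (l q * -c q)) • ((c p)⁻¹ • p + (-c q)⁻¹ • q) ∈ cone (fmStep P a) :=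
        sum_mem fun p hp => sum_mem fun q hq =>
          smul_mem_cone (mul_nonneg (hpos p hp) (hneg q hq)) (mem_cone_of_mem
            (Finset.mem_union_right _ (Finset.mem_image₂_of_mem hp hq)))
      have e : ∑ p ∈ P with 0 < c p, ∑ q ∈ P with c q < 0,
          ((l p * c p) * (l q * -c q)) • ((c p)⁻¹ • p + (-c q)⁻¹ • q) =
          S • (∑ p ∈ P with 0 < c p, l p • p + ∑ q ∈ P with c q < 0, l q • q) := by
        rw [smul_add]
        nth_rewrite 1 [← hS']
        rw [hS, Finset.sum_smul_sum, Finset.sum_smul_sum, Finset.sum_comm,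
          ← Finset.sum_comm (s := P.filter (0 < c ·)), Finset.sum_comm (s := P.filter (c · < 0)),
          ← Finset.sum_add_distrib]
        refine Finset.sum_congr rfl fun p hp => ?_
        rw [← Finset.sum_add_distrib]
        refine Finset.sum_congr rfl fun q hq => ?_
        have hp' : c p ≠ 0 := (Finset.mem_filter.mp hp).2.ne'
        have hq' : c q ≠ 0 := (Finset.mem_filter.mp hq).2.ne
        rw [smul_add, smul_smul, smul_smul, smul_smul, smul_smul]
        congr 2 <;> field_simp
      rw [add_assoc]
      refine add_mem hzero ?_
      have := smul_mem_cone (inv_nonneg.mpr h0.le) hpair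
      rwa [e, smul_smul, inv_mul_cancel₀ h0.ne', one_smul] at this

theorem mem_cone_foldl_fmStep {l : List (σ →₀ ℕ)} {f : MvPolynomial σ ℚ} :
    f ∈ cone (l.foldl fmStep P) ↔ f ∈ cone P ∧ ∀ a ∈ l, coeff a f = 0 := by
  induction l generalizing P with
  | nil => simp
  | cons a l ih => rw [List.foldl_cons, ih, mem_cone_fmStep, List.forall_mem_cons, and_assoc]

/-- A monomial that occurs in no generator occurs in no element of the cone, so eliminating the
listed monomials removes everything outside `N`. -/
theorem PolyhedralProject.mem_cone_iff {N : Set (σ →₀ ℕ)} {P' : Finset (MvPolynomial σ ℚ)}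
    (h : PolyhedralProject N P P') {f : MvPolynomial σ ℚ} :
    f ∈ cone P' ↔ f ∈ cone P ∧ ∀ a ∈ f.support, a ∈ N := by
  obtain ⟨l, -, hl, rfl⟩ := h
  rw [mem_cone_foldl_fmStep]
  refine and_congr_right fun hf => ⟨fun h a ha => ?_, fun h a ha => ?_⟩
  · by_contra hN
    have hP : ∃ p ∈ P, a ∈ p.support := by
      by_contra! hP
      have : f ∈ LinearMap.ker (lcoeff ℚ a) :=
        cone_le_of_subset_submodule (fun p hp => notMem_support_iff.mp (hP p hp)) hf
      exact mem_support_iff.mp ha this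
    exact mem_support_iff.mp ha (h a ((hl a).mpr ⟨hN, hP⟩))
  · by_contra h0
    exact ((hl a).mp ha).1 (h a (mem_support_iff.mpr h0))

open scoped Classical in
theorem exists_polyhedralProject (N : Set (σ →₀ ℕ)) (P : Finset (MvPolynomial σ ℚ)) :
    ∃ P', PolyhedralProject N P P' :=
  ⟨_, ((P.biUnion support).filter (· ∉ N)).toList, Finset.nodup_toList _,
    fun a => by simp [and_comm], rfl⟩

end FourierMotzkin

/-! ### Elimination orderings and projection. -/

section Project

variable {σ τ : Type*} {ι : σ → τ} {m : MonomialOrder τ} {n : MonomialOrder σ}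

/-- `n` is the restriction, along the inclusion `ι` of variables, of the ordering `m`, which is an
elimination ordering for the variables in the range of `ι`. -/
structure IsElimination (m : MonomialOrder τ) (n : MonomialOrder σ) (ι : σ → τ) : Prop where
  injective : Function.Injective ι
  le_iff : ∀ a b : σ →₀ ℕ, n.toSyn a ≤ n.toSyn b ↔
    m.toSyn (a.mapDomain ι) ≤ m.toSyn (b.mapDomain ι)
  mem_range : ∀ (a : τ →₀ ℕ) (b : σ →₀ ℕ), m.toSyn a ≤ m.toSyn (b.mapDomain ι) →
    a ∈ Set.range (Finsupp.mapDomain ι : (σ →₀ ℕ) → τ →₀ ℕ)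

theorem exists_rename_eq {f : MvPolynomial τ ℚ}
    (h : ∀ a ∈ f.support, a ∈ Set.range (Finsupp.mapDomain ι : (σ →₀ ℕ) → τ →₀ ℕ)) :
    ∃ g, rename ι g = f := by
  choose! e he using h
  refine ⟨∑ a ∈ f.support, monomial (e a) (coeff a f), ?_⟩
  rw [map_sum]
  conv_rhs => rw [f.as_sum]
  refine Finset.sum_congr rfl fun a ha => ?_
  rw [rename_monomial, he a ha]

theorem mapDomain_le_mapDomain_iff (hι : Function.Injective ι) {a b : σ →₀ ℕ} :
    a.mapDomain ι ≤ b.mapDomain ι ↔ a ≤ b := by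
  refine ⟨fun h x => ?_, fun h => Finsupp.mapDomain_mono h⟩
  simpa [Finsupp.mapDomain_apply hι] using h (ι x)

namespace IsElimination

theorem degree_rename (h : IsElimination m n ι) (f : MvPolynomial σ ℚ) :
    m.degree (rename ι f) = (n.degree f).mapDomain ι := by
  classical
  by_cases hf : f = 0
  · simp [hf]
  apply m.toSyn.injective
  apply le_antisymm
  · rw [m.degree_le_iff, support_rename_of_injective h.injective]
    intro c hc
    obtain ⟨a, ha, rfl⟩ := Finset.mem_image.mp hc
    exact (h.le_iff _ _).mp (n.le_degree ha)
  · apply m.le_degree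
    rw [support_rename_of_injective h.injective]
    exact Finset.mem_image_of_mem _ (n.degree_mem_support hf)

theorem degree_rename_le_iff (h : IsElimination m n ι) {f : MvPolynomial σ ℚ} {a : σ →₀ ℕ} :
    m.degree (rename ι f) ≤ a.mapDomain ι ↔ n.degree f ≤ a := by
  rw [h.degree_rename, mapDomain_le_mapDomain_iff h.injective]

/-- Every monomial of `g` is at most its leading monomial, hence at most a monomial over `σ`; the
elimination property puts all of them over `σ`. -/
theorem exists_rename_of_degree_le (h : IsElimination m n ι) {g : MvPolynomial τ ℚ} {a : σ →₀ ℕ}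
    (hg : m.degree g ≤ a.mapDomain ι) : ∃ z, rename ι z = g ∧ n.degree z ≤ a := by
  obtain ⟨z, rfl⟩ := exists_rename_eq (f := g) fun c hc =>
    h.mem_range c a ((m.le_degree hc).trans (m.toSyn_monotone hg))
  exact ⟨z, rfl, h.degree_rename_le_iff.mp hg⟩

variable {G : Finset (MvPolynomial τ ℚ)} {Z' : Finset (MvPolynomial σ ℚ)}

theorem rename_mem_irreducibles_iff (h : IsElimination m n ι) (hZ' : ∀ z, z ∈ Z' ↔ rename ι z ∈ G)
    {f : MvPolynomial σ ℚ} : rename ι f ∈ irreducibles m G ↔ f ∈ irreducibles n Z' := by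
  classical
  constructor
  · intro hf a ha z hz hle
    refine hf (a.mapDomain ι) ?_ _ ((hZ' z).mp hz) (h.degree_rename_le_iff.mpr hle)
    rw [support_rename_of_injective h.injective]
    exact Finset.mem_image_of_mem _ ha
  · intro hf c hc g hg hle
    rw [support_rename_of_injective h.injective] at hc
    obtain ⟨a, ha, rfl⟩ := Finset.mem_image.mp hc
    obtain ⟨z, rfl, hz⟩ := h.exists_rename_of_degree_le hle
    exact hf a ha z ((hZ' z).mpr hg) hz

theorem rename_mem_ideal (hZ' : ∀ z, z ∈ Z' ↔ rename ι z ∈ G) {f : MvPolynomial σ ℚ}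
    (hf : f ∈ ideal Z') : rename ι f ∈ ideal G :=
  (Ideal.span_le (I := (ideal G).comap (rename ι))).mpr
    (fun z hz => Ideal.subset_span ((hZ' z).mp hz)) hf

theorem isGroebnerBasis (h : IsElimination m n ι) {I : Ideal (MvPolynomial τ ℚ)}
    (hG : IsGroebnerBasis m G I)
    (hZ' : ∀ z, z ∈ Z' ↔ rename ι z ∈ G) : IsGroebnerBasis n Z' (ideal Z') := by
  refine ⟨fun h0 => hG.1 (by simpa using (hZ' 0).mp h0), rfl, fun f hf hf0 => ?_⟩
  obtain ⟨g, hg, hle⟩ := hG.self.2.2 _ (rename_mem_ideal hZ' hf)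
    (by rwa [Ne, map_eq_zero_iff _ (rename_injective _ h.injective)])
  rw [h.degree_rename] at hle
  obtain ⟨z, rfl, hz⟩ := h.exists_rename_of_degree_le hle
  exact ⟨z, (hZ' z).mpr hg, hz⟩

end IsElimination

variable {Z P : Finset (MvPolynomial τ ℚ)} {Z' P' : Finset (MvPolynomial σ ℚ)}

theorem Project.isReducedPair (h : IsElimination m n ι) (hp : Project m ι Z P Z' P') :
    IsReducedPair n Z' P' := by
  obtain ⟨G, R, Q, hG, hR, hQ, hZ', hP'⟩ := hp
  refine ⟨h.isGroebnerBasis hG hZ', fun p hp => isNormalForm_iff.mpr ⟨by simp, ?_⟩⟩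
  rw [← h.rename_mem_irreducibles_iff hZ']
  refine cone_le_of_subset_submodule (P := R) (fun q hq => ?_)
    (hQ.mem_cone_iff.mp (mem_cone_of_mem ((hP' p).mp hp))).1
  obtain ⟨_, _, hq'⟩ := (hR q).mp hq
  exact hq'.2

/-- For the converse, write `rename ι f = z + r` with `r` in the cone of the normal forms. The
normal form `f'` of `f` modulo `Z'` stays irreducible modulo `G` and is congruent to `r`, so it
equals `r`. Thus `r` has only monomials over `σ` and survives the elimination. -/
theorem Project.mem_algHull_iff (h : IsElimination m n ι) (hp : Project m ι Z P Z' P')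
    {f : MvPolynomial σ ℚ} : f ∈ algHull Z' P' ↔ rename ι f ∈ algHull Z P := by
  classical
  obtain ⟨G, R, Q, hG, hR, hQ, hZ', hP'⟩ := hp
  rw [← algHull_normalForm hG (fun q hq => (hR q).mp hq)
    (fun p hp q hpq _ => (hR q).mpr ⟨p, hp, hpq⟩)]
  constructor
  · rintro ⟨z, hz, p, hp, rfl⟩
    rw [map_add]
    refine ⟨_, IsElimination.rename_mem_ideal hZ' hz, rename ι p, ?_, rfl⟩
    have : rename ι p ∈ cone Q := hull_le_comap (rename ι).toLinearMap
      (fun p hp => mem_cone_of_mem ((hP' p).mp hp)) hp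
    exact (hQ.mem_cone_iff.mp this).1
  · rintro ⟨z, hz, r, hr, hzr⟩
    obtain ⟨f', hf'⟩ := exists_isNormalForm (m := n) (h.isGroebnerBasis hG hZ').1 f
    have hrirr : r ∈ irreducibles m G := by
      refine cone_le_of_subset_submodule (P := R) (fun q hq => ?_) hr
      obtain ⟨_, _, hq'⟩ := (hR q).mp hq
      exact hq'.2
    have hfr : rename ι f' = r := by
      refine hG.eq_of_sub_mem ((h.rename_mem_irreducibles_iff hZ').mpr hf'.2) hrirr ?_
      have h1 := IsElimination.rename_mem_ideal hZ' hf'.1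
      rw [map_sub] at h1
      have e : rename ι f' - r = z - (rename ι f - rename ι f') := by
        rw [hzr]; ring
      exact e ▸ sub_mem hz h1
    have hQ' : rename ι f' ∈ cone Q := by
      refine hQ.mem_cone_iff.mpr ⟨hfr ▸ hr, fun a ha => ?_⟩
      rw [support_rename_of_injective h.injective] at ha
      obtain ⟨b, _, rfl⟩ := Finset.mem_image.mp ha
      exact ⟨b, rfl⟩
    -- All of `Q` lies over `σ`, so `cone Q` is the image of `cone P'`.
    have himage : (Q : Set (MvPolynomial τ ℚ)) =
        (rename ι).toLinearMap.restrictScalars {c : ℚ // 0 ≤ c} '' P' := by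
      ext q
      constructor
      · intro hq
        obtain ⟨p, rfl⟩ := exists_rename_eq (f := q) (hQ.mem_cone_iff.mp (mem_cone_of_mem hq)).2
        exact ⟨p, (hP' p).mpr hq, rfl⟩
      · rintro ⟨p, hp, rfl⟩
        exact (hP' p).mp hp
    have hcone : f' ∈ cone P' := by
      rw [cone, PointedCone.hull, himage, ← Submodule.map_span] at hQ'
      obtain ⟨p, hp, hpf⟩ := hQ'
      exact rename_injective _ h.injective hpf ▸ hp
    exact ⟨f - f', hf'.1, f', hcone, by ring⟩

theorem exists_project [Finite τ] (m : MonomialOrder τ) (hι : Function.Injective ι)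
    (Z P : Finset (MvPolynomial τ ℚ)) : ∃ Z' P', Project m ι Z P Z' P' := by
  obtain ⟨G, hG⟩ := exists_isGroebnerBasis m (ideal Z)
  obtain ⟨R, hR⟩ := exists_finset_isNormalForm hG.self P
  obtain ⟨Q, hQ⟩ := exists_polyhedralProject (Set.range (Finsupp.mapDomain ι)) R
  have hinj := rename_injective (R := ℚ) ι hι
  exact ⟨G.preimage _ hinj.injOn, Q.preimage _ hinj.injOn, G, R, Q, hG, hR, hQ,
    fun z => Finset.mem_preimage, fun p => Finset.mem_preimage⟩

end Project

/-! ### The two elimination orderings. -/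

section Orders

variable {σ : Type*}

/-- The part of `a` outside `X` is compared first; for a monomial over `X` this part is 0, the least
value, so anything below is over `X` too. -/
theorem isElimination_elimination (m : MonomialOrder σ) (X : Set σ) :
    IsElimination (m.elimination X) ((m.elimination X).restrict X) (Subtype.val : X → σ) where
  injective := Subtype.val_injective
  le_iff _ _ := Iff.rfl
  mem_range a b h := by
    classical
    have h' : toLex (m.toSyn (a.filter (· ∉ X)), m.toSyn (a.filter (· ∈ X))) ≤
      toLex (m.toSyn ((b.mapDomain Subtype.val).filter (· ∉ X)),
        m.toSyn ((b.mapDomain Subtype.val).filter (· ∈ X))) := h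
    have hb : (b.mapDomain (Subtype.val : X → σ)).filter (· ∉ X) = 0 := by
      rw [Finsupp.filter_eq_zero_iff]
      intro x hx
      exact Finsupp.mapDomain_of_notMem_range _ _ (by simpa using hx)
    have h1 := (Prod.Lex.toLex_le_toLex'.mp h').1
    simp only [hb, map_zero] at h1
    have h2 : a.filter (· ∉ X) = 0 := by
      apply m.toSyn.injective
      rw [map_zero]
      refine le_antisymm h1 ?_
      rw [← m.bot_eq_zero]
      exact bot_le
    rw [Finsupp.filter_eq_zero_iff] at h2
    refine ⟨a.comapDomain Subtype.val Subtype.val_injective.injOn,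
      Finsupp.mapDomain_comapDomain _ Subtype.val_injective _ fun x hx => ?_⟩
    by_contra hxX
    exact Finsupp.mem_support_iff.mp hx (h2 x (by simpa using hxX))

theorem isElimination_tag (m : MonomialOrder σ) : IsElimination m.tag m some where
  injective := Option.some_injective σ
  le_iff a b := by
    have e : m.tag.toSyn (a.mapDomain some) ≤ m.tag.toSyn (b.mapDomain some) ↔
      toLex ((a.mapDomain some) none, m.toSyn (a.mapDomain some).some) ≤
      toLex ((b.mapDomain some) none, m.toSyn (b.mapDomain some).some) := Iff.rfl
    have hs : ∀ c : σ →₀ ℕ, (c.mapDomain some).some = c := fun c => by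
      ext x
      rw [Finsupp.some_apply, Finsupp.mapDomain_apply (Option.some_injective σ)]
    have hn : ∀ c : σ →₀ ℕ, c.mapDomain some none = 0 := fun c =>
      Finsupp.mapDomain_of_notMem_range _ _ (by simp)
    rw [e, Prod.Lex.toLex_le_toLex, hs, hs, hn, hn]
    simp
  mem_range a b h := by
    have h' : toLex (a none, m.toSyn a.some) ≤
      toLex ((b.mapDomain some) none, m.toSyn (b.mapDomain some).some) := h
    have h1 := (Prod.Lex.toLex_le_toLex'.mp h').1
    have hn : b.mapDomain some none = 0 := Finsupp.mapDomain_of_notMem_range _ _ (by simp)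
    have h0 : a none = 0 := by simpa [hn] using h1
    refine ⟨a.comapDomain some (Option.some_injective σ).injOn,
      Finsupp.mapDomain_comapDomain _ (Option.some_injective σ) _ fun x hx => ?_⟩
    cases x with
    | none => exact absurd h0 (Finsupp.mem_support_iff.mp hx)
    | some x => exact ⟨x, rfl⟩

end Orders

/-! ### Intersection by means of a tag variable. -/

section Intersect

variable {σ : Type*} {Z₁ P₁ Z₂ P₂ Z P : Finset (MvPolynomial σ ℚ)} {m : MonomialOrder σ}

/-- Substitution of the constant `c` for the extra variable. -/
noncomputable def substNone (σ : Type*) (c : ℚ) :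
    MvPolynomial (Option σ) ℚ →ₐ[ℚ] MvPolynomial σ ℚ :=
  aeval fun x => x.elim (C c) X

@[simp] theorem substNone_X_none (c : ℚ) : substNone σ c (X none) = C c := by
  simp [substNone]

@[simp] theorem substNone_rename (c : ℚ) (p : MvPolynomial σ ℚ) :
    substNone σ c (rename some p) = p := by
  rw [substNone, aeval_rename]
  exact aeval_X_left_apply p

theorem algHull_map_mem {τ : Type*} {A B : Finset (MvPolynomial τ ℚ)}
    (L : MvPolynomial τ ℚ →ₗ[ℚ] MvPolynomial σ ℚ)
    {D : PointedCone ℚ (MvPolynomial σ ℚ)} (hA : ∀ a ∈ ideal A, L a ∈ D)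
    (hB : ∀ b ∈ B, L b ∈ D) {f : MvPolynomial τ ℚ} (hf : f ∈ algHull A B) : L f ∈ D :=
  algHull_le (D := PointedCone.comap L D) hA hB hf

theorem substNone_mem {f : MvPolynomial (Option σ) ℚ} {c : ℚ}
    {A B : Finset (MvPolynomial (Option σ) ℚ)}
    (hA : ∀ a ∈ A, substNone σ c a ∈ ideal Z) (hB : ∀ b ∈ B, substNone σ c b ∈ algHull Z P)
    (hf : f ∈ algHull A B) : substNone σ c f ∈ algHull Z P := by
  refine algHull_map_mem (substNone σ c).toLinearMap (fun a ha => mem_algHull_of_mem_ideal ?_) hB hf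
  exact (Ideal.span_le (I := (ideal Z).comap (substNone σ c))).mpr hA ha

theorem mul_rename_mem {t : MvPolynomial (Option σ) ℚ} {A B : Finset (MvPolynomial (Option σ) ℚ)}
    (hA : tagWith t Z ⊆ A) (hB : tagWith t P ⊆ B) {f : MvPolynomial σ ℚ} (hf : f ∈ algHull Z P) :
    t * rename some f ∈ algHull A B := by
  classical
  refine algHull_map_mem ((LinearMap.mulLeft ℚ t).comp (rename some).toLinearMap)
    (fun a ha => mem_algHull_of_mem_ideal ?_)
    (fun b hb => mem_algHull_of_mem_cone (mem_cone_of_mem (hB (Finset.mem_image_of_mem _ hb)))) hf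
  change t * rename some a ∈ ideal A
  induction ha using Submodule.span_induction with
  | mem z hz => exact Ideal.subset_span (hA (Finset.mem_image_of_mem _ hz))
  | zero => simp
  | add x y _ _ hx hy => simpa only [map_add, mul_add] using add_mem hx hy
  | smul r x _ hx =>
    rw [smul_eq_mul, map_mul, mul_left_comm]
    exact Ideal.mul_mem_left _ _ hx

theorem Intersect.isReducedPair (h : Intersect m Z₁ P₁ Z₂ P₂ Z P) : IsReducedPair m Z P :=
  Project.isReducedPair (isElimination_tag m) h

/-- Substituting 1 or 0 for the tag `t` kills one of the two families and recovers the other.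
Conversely, f = t f + (1 - t) f. -/
theorem Intersect.mem_algHull_iff (h : Intersect m Z₁ P₁ Z₂ P₂ Z P) {f : MvPolynomial σ ℚ} :
    f ∈ algHull Z P ↔ f ∈ algHull Z₁ P₁ ∧ f ∈ algHull Z₂ P₂ := by
  classical
  rw [Project.mem_algHull_iff (isElimination_tag m) h]
  constructor
  · intro hf
    constructor
    · rw [← substNone_rename 1 f]
      refine substNone_mem (fun a ha => ?_) (fun a ha => ?_) hf
      all_goals
        simp only [tagWith, Finset.mem_union, Finset.mem_image] at ha
        rcases ha with ⟨z, hz, rfl⟩ | ⟨z, hz, rfl⟩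
      · simpa [ideal] using Ideal.subset_span hz
      · simp
      · simpa using mem_algHull_of_mem_cone (mem_cone_of_mem hz)
      · simp
    · rw [← substNone_rename 0 f]
      refine substNone_mem (fun a ha => ?_) (fun a ha => ?_) hf
      all_goals
        simp only [tagWith, Finset.mem_union, Finset.mem_image] at ha
        rcases ha with ⟨z, hz, rfl⟩ | ⟨z, hz, rfl⟩
      · simp
      · simpa [ideal] using Ideal.subset_span hz
      · simp
      · simpa using mem_algHull_of_mem_cone (mem_cone_of_mem hz)
  · rintro ⟨h₁, h₂⟩
    have e : rename some f = X none * rename some f + (1 - X none) * rename some f := by ring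
    rw [e]
    exact add_mem
      (mul_rename_mem Finset.subset_union_left Finset.subset_union_left h₁)
      (mul_rename_mem Finset.subset_union_right Finset.subset_union_right h₂)

theorem exists_intersect [Finite σ] (m : MonomialOrder σ)
    (Z₁ P₁ Z₂ P₂ : Finset (MvPolynomial σ ℚ)) : ∃ Z P, Intersect m Z₁ P₁ Z₂ P₂ Z P :=
  exists_project m.tag (Option.some_injective σ) _ _

end Intersect

end AlgCone

/-! ### Models and their cones of non-negative polynomials. -/

namespace LinearRealRing

variable {A : Type*} [LinearRealRing A]

instance : IsOrderedAddMonoid A where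
  add_le_add_left x y h z := compatibility x y z h

variable {Y : Type*} (v : Y → A)

/-- Evaluation of polynomials in a model, as a ring homomorphism. -/
noncomputable def evalHom : MvPolynomial Y ℚ →+* A := eval₂Hom (ratHom A) v

theorem evalPoly_eq_evalHom (p : MvPolynomial Y ℚ) : evalPoly v p = evalHom v p := rfl

/-- Any two ring homomorphisms out of ℚ agree, so a homomorphism is determined by the images of the
variables. -/
theorem evalPoly_unique (φ : MvPolynomial Y ℚ →+* A) (p : MvPolynomial Y ℚ) :
    evalPoly (fun y => φ (X y)) p = φ p := by
  have h : evalHom (fun y => φ (X y)) = φ := by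
    refine MvPolynomial.ringHom_ext (fun r => ?_) (fun y => ?_)
    · exact DFunLike.congr_fun
        (Subsingleton.elim ((evalHom (fun y => φ (X y))).comp C) (φ.comp C)) r
    · simp [evalHom]
  rw [evalPoly_eq_evalHom, h]

/-- The polynomials with a non-negative value in a model. -/
noncomputable def nonnegCone : PointedCone ℚ (MvPolynomial Y ℚ) where
  carrier := {p | 0 ≤ evalHom v p}
  zero_mem' := by simp
  add_mem' {p q} hp hq := by
    change 0 ≤ evalHom v (p + q)
    rw [map_add]
    exact add_nonneg hp hq
  smul_mem' := by
    rintro ⟨c, hc⟩ p hp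
    change 0 ≤ evalHom v (c • p)
    -- Clearing the denominator leaves a multiple by a natural number, so unperforatedness gives
    -- closure under rational scalars.
    refine perforation_free c.den c.pos _ ?_
    have e : c.den • c • p = c.num.toNat • p := by
      rw [← Nat.cast_smul_eq_nsmul ℚ, ← Nat.cast_smul_eq_nsmul ℚ, smul_smul, Rat.den_mul_eq_num]
      congr 1
      exact_mod_cast (Int.toNat_of_nonneg (Rat.num_nonneg.mpr hc)).symm
    rw [← map_nsmul, e, map_nsmul]
    exact nsmul_nonneg hp _

theorem mem_nonnegCone {p : MvPolynomial Y ℚ} : p ∈ nonnegCone v ↔ 0 ≤ evalPoly v p := Iff.rfl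

theorem mem_nonnegCone_iff_zero_le {p : MvPolynomial Y ℚ} :
    p ∈ nonnegCone v ↔ evalPoly v 0 ≤ evalPoly v p := by
  rw [mem_nonnegCone, evalPoly_eq_evalHom v 0, map_zero]

theorem le_iff_sub_mem_nonnegCone {p q : MvPolynomial Y ℚ} :
    evalPoly v p ≤ evalPoly v q ↔ q - p ∈ nonnegCone v := by
  rw [mem_nonnegCone, evalPoly_eq_evalHom v (q - p), map_sub, sub_nonneg]
  rfl

theorem eq_zero_iff_mem_nonnegCone {p : MvPolynomial Y ℚ} :
    evalPoly v p = 0 ↔ p ∈ nonnegCone v ∧ -p ∈ nonnegCone v := by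
  rw [mem_nonnegCone, mem_nonnegCone, evalPoly_eq_evalHom v (-p), map_neg, neg_nonneg, and_comm]
  exact le_antisymm_iff

theorem evalPoly_eq_zero_of_mem_ideal {Z : Finset (MvPolynomial Y ℚ)}
    (hZ : ∀ z ∈ Z, evalPoly v z = 0) {f : MvPolynomial Y ℚ} (hf : f ∈ AlgCone.ideal Z) :
    evalPoly v f = 0 :=
  (Ideal.span_le (I := RingHom.ker (evalHom v))).mpr hZ hf

theorem algHull_le_nonnegCone {Z P : Finset (MvPolynomial Y ℚ)}
    (hZ : ∀ z ∈ Z, evalPoly v z = 0) (hP : ∀ p ∈ P, p ∈ nonnegCone v) :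
    AlgCone.algHull Z P ≤ nonnegCone v :=
  AlgCone.algHull_le
    (fun _ hf => ((eq_zero_iff_mem_nonnegCone v).mp (evalPoly_eq_zero_of_mem_ideal v hZ hf)).1) hP

theorem eval_ideal_eq_zero {Z P : Finset (MvPolynomial Y ℚ)}
    (h : AlgCone.algHull Z P ≤ nonnegCone v) {z : MvPolynomial Y ℚ} (hz : z ∈ AlgCone.ideal Z) :
    evalPoly v z = 0 :=
  (eq_zero_iff_mem_nonnegCone v).mpr ⟨h (AlgCone.mem_algHull_of_mem_ideal hz),
    h (AlgCone.mem_algHull_of_mem_ideal (neg_mem hz))⟩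

theorem algHull_le_nonnegCone_iff {Z P : Finset (MvPolynomial Y ℚ)} :
    AlgCone.algHull Z P ≤ nonnegCone v ↔
      (∀ z ∈ Z, evalPoly v z = 0) ∧ ∀ p ∈ P, p ∈ nonnegCone v :=
  ⟨fun h => ⟨fun _ hz => eval_ideal_eq_zero v h (Ideal.subset_span hz),
    fun _ hp => h (AlgCone.mem_algHull_of_mem_cone (AlgCone.mem_cone_of_mem hp))⟩,
    fun h => algHull_le_nonnegCone v h.1 h.2⟩

/-- The quotient by the ideal of additive units of a cone of polynomials that contains `1`, ordered
by the image of the cone. -/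
@[reducible] noncomputable def quotientOfCone (I : Ideal (MvPolynomial Y ℚ))
    (K : PointedCone ℚ (MvPolynomial Y ℚ)) (hI : ∀ f ∈ I, f ∈ K) (h1 : 1 ∈ K) (hne : 1 ∉ I)
    (hu : ∀ f ∈ K, -f ∈ K → f ∈ I) : LinearRealRing (MvPolynomial Y ℚ ⧸ I) where
  __ := (inferInstance : CommRing (MvPolynomial Y ℚ ⧸ I))
  le x y := ∃ f ∈ K, Ideal.Quotient.mk I f = y - x
  le_refl x := ⟨0, zero_mem K, by simp⟩
  le_trans := by
    rintro x y z ⟨f, hf, hf'⟩ ⟨g, hg, hg'⟩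
    exact ⟨f + g, add_mem hf hg, by rw [map_add, hf', hg']; ring⟩
  le_antisymm := by
    rintro x y ⟨f, hf, hf'⟩ ⟨g, hg, hg'⟩
    have hfg : f + g ∈ I := by
      rw [← Ideal.Quotient.eq_zero_iff_mem, map_add, hf', hg']
      ring
    -- Modulo `I`, `g` is `-f`, so `f` is a unit of `K`.
    have hfI : f ∈ I := hu f hf (by
      have : -f = g + -(f + g) := by ring
      exact this ▸ add_mem hg (hI _ (neg_mem hfg)))
    rw [Ideal.Quotient.eq_zero_iff_mem.mpr hfI] at hf'
    exact (sub_eq_zero.mp hf'.symm).symm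
  compatibility := by
    rintro x y z ⟨f, hf, hf'⟩
    exact ⟨f, hf, by rw [hf']; ring⟩
  zero_le_one' := ⟨1, h1, by simp⟩
  zero_ne_one' h := hne (by
    rw [← Ideal.Quotient.eq_zero_iff_mem, map_one]
    exact h.symm)
  divisibility n hn := by
    refine ⟨Ideal.Quotient.mk I ((n : ℚ)⁻¹ • 1), ?_⟩
    rw [← map_nsmul, ← Nat.cast_smul_eq_nsmul ℚ, smul_smul,
      mul_inv_cancel₀ (by positivity), one_smul, map_one]
  perforation_free := by
    rintro n hn x ⟨f, hf, hf'⟩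
    obtain ⟨p, rfl⟩ := Ideal.Quotient.mk_surjective x
    refine ⟨(n : ℚ)⁻¹ • f, AlgCone.smul_mem_cone (by positivity) hf, ?_⟩
    rw [sub_zero, ← map_nsmul, Ideal.Quotient.eq] at hf'
    rw [sub_zero, Ideal.Quotient.eq]
    have e : (n : ℚ)⁻¹ • f - p = (n : ℚ)⁻¹ • (f - n • p) := by
      rw [smul_sub, ← Nat.cast_smul_eq_nsmul ℚ n p, smul_smul, inv_mul_cancel₀ (by positivity),
        one_smul]
    rw [e]
    exact Submodule.smul_of_tower_mem I _ hf'

/-- A regular cone of polynomials is the cone of non-negative polynomials of some model. -/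
theorem exists_nonnegCone_eq.{u} {Y : Type u} (I : Ideal (MvPolynomial Y ℚ))
    (K : PointedCone ℚ (MvPolynomial Y ℚ)) (hI : ∀ f ∈ I, f ∈ K) (h1 : 1 ∈ K) (hne : 1 ∉ I)
    (hu : ∀ f ∈ K, -f ∈ K → f ∈ I) :
    ∃ (A : Type u) (_ : LinearRealRing A) (v : Y → A), nonnegCone v = K := by
  let inst := quotientOfCone I K hI h1 hne hu
  refine ⟨MvPolynomial Y ℚ ⧸ I, inst, fun y => Ideal.Quotient.mk I (X y), ?_⟩
  ext p
  rw [mem_nonnegCone, evalPoly_unique (Ideal.Quotient.mk I)]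
  constructor
  · rintro ⟨f, hf, hf'⟩
    rw [sub_zero, eq_comm, Ideal.Quotient.eq] at hf'
    have e : p = (p - f) + f := by ring
    exact e ▸ add_mem (hI _ hf') hf
  · exact fun hp => ⟨p, hp, by rw [sub_zero]⟩

end LinearRealRing

/-! ### Semantics of disjunctive normal forms. -/

section Formulas

open LinearRealRing

variable {Y : Type*} {A : Type*} [LinearRealRing A] (v : Y → A)

/-- Truth of a cube in a model. -/
def Cube.Holds (c : Cube Y) : Prop :=
  (∀ p ∈ c.nonneg, p ∈ nonnegCone v) ∧ (∀ q ∈ c.notNonneg, q ∉ nonnegCone v) ∧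
    ∀ r ∈ c.notZero, evalPoly v r ≠ 0

theorem Cube.holds_meet (c d : Cube Y) : (c.meet d).Holds v ↔ c.Holds v ∧ d.Holds v := by
  simp only [Cube.Holds, Cube.meet, List.forall_mem_append]
  tauto

theorem Formula.evalPoly_eq_iff (p q : MvPolynomial Y ℚ) :
    evalPoly v p = evalPoly v q ↔ evalPoly v (p - q) = 0 := by
  rw [evalPoly_eq_evalHom v (p - q), map_sub, sub_eq_zero]
  rfl

theorem Formula.exists_meet_holds (L M : List (Cube Y)) :
    (∃ c ∈ L.flatMap fun c => M.map c.meet, c.Holds v) ↔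
      (∃ c ∈ L, c.Holds v) ∧ ∃ d ∈ M, d.Holds v := by
  simp only [List.mem_flatMap, List.mem_map]
  constructor
  · rintro ⟨_, ⟨c, hc, d, hd, rfl⟩, h⟩
    rw [Cube.holds_meet] at h
    exact ⟨⟨c, hc, h.1⟩, d, hd, h.2⟩
  · rintro ⟨⟨c, hc, h⟩, d, hd, h'⟩
    exact ⟨_, ⟨c, hc, d, hd, rfl⟩, (Cube.holds_meet v c d).mpr ⟨h, h'⟩⟩

theorem Formula.exists_append_holds (L M : List (Cube Y)) :
    (∃ c ∈ L ++ M, c.Holds v) ↔ (∃ c ∈ L, c.Holds v) ∨ ∃ d ∈ M, d.Holds v := by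
  simp only [List.mem_append, or_and_right, exists_or]

/-- Both polarities are needed in one induction, since negation exchanges them. -/
theorem Formula.exists_dnf_holds (F : Formula Y) :
    ((∃ c ∈ F.dnf true, c.Holds v) ↔ F.Holds v) ∧
      ((∃ c ∈ F.dnf false, c.Holds v) ↔ ¬ F.Holds v) := by
  induction F with
  | tru => simp [dnf, Holds, Cube.Holds]
  | fls => simp [dnf, Holds, Cube.Holds]
  | le p q => simp [dnf, Holds, Cube.Holds, le_iff_sub_mem_nonnegCone]
  | eq p q =>
    simp only [dnf, Holds, Cube.Holds, evalPoly_eq_iff v p q]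
    rw [eq_zero_iff_mem_nonnegCone, neg_sub]
    simp [eq_zero_iff_mem_nonnegCone]
  | and F G hF hG =>
    rw [dnf, dnf, exists_meet_holds, exists_append_holds, hF.1, hF.2, hG.1, hG.2, Holds]
    tauto
  | or F G hF hG =>
    rw [dnf, dnf, exists_meet_holds, exists_append_holds, hF.1, hF.2, hG.1, hG.2, Holds]
    tauto
  | not F hF =>
    rw [dnf, dnf, hF.1, hF.2, Holds]
    tauto

theorem Formula.holds_conj {L : List (Formula Y)} :
    (conj L).Holds v ↔ ∀ F ∈ L, F.Holds v := by
  induction L with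
  | nil => simp [conj, Holds]
  | cons F L ih => rw [conj, Holds, ih, List.forall_mem_cons]

theorem Formula.nonneg_of_mem_dnf_false_conj {L : List (Formula Y)}
    (h : ∀ F ∈ L, ∀ c ∈ F.dnf false, c.nonneg = []) :
    ∀ c ∈ (conj L).dnf false, c.nonneg = [] := by
  induction L with
  | nil => simp [conj, dnf]
  | cons F L ih =>
    intro c hc
    rw [conj, dnf, List.mem_append] at hc
    rw [List.forall_mem_cons] at h
    rcases hc with hc | hc
    exacts [h.1 c hc, ih h.2 c hc]

end Formulas

/-! ### The blocking clause. -/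

namespace LazyConsequence

open LinearRealRing AlgCone

variable {Y : Type*} {X : Set Y} {Z P : Finset (MvPolynomial X ℚ)}

theorem evalPoly_rename {A : Type*} [LinearRealRing A] (v : Y → A) (p : MvPolynomial X ℚ) :
    evalPoly v (rename Subtype.val p) = evalPoly (fun x : X => v x) p :=
  eval₂_rename _ _ _ _

theorem holds_blocked_iff {A : Type*} [LinearRealRing A] (v : Y → A) :
    (blocked Z P).Holds v ↔ algHull Z P ≤ nonnegCone fun x : X => v x := by
  rw [algHull_le_nonnegCone_iff, blocked, Formula.Holds, Formula.holds_conj, Formula.holds_conj]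
  simp only [List.forall_mem_map, Finset.mem_toList, Formula.Holds]
  refine and_congr (forall₂_congr fun z _ => ?_) (forall₂_congr fun p _ => ?_)
  · rw [evalPoly_rename, evalPoly_eq_evalHom v 0, map_zero]
  · rw [← mem_nonnegCone_iff_zero_le, mem_nonnegCone, mem_nonnegCone, evalPoly_rename]

theorem mem_consequenceCone_iff.{u} {Y : Type u} {X : Set Y} {F : Formula Y}
    {p : MvPolynomial X ℚ} : p ∈ F.consequenceCone X ↔
      ∀ (A : Type u) [LinearRealRing A] (v : Y → A), F.Holds v →
        p ∈ nonnegCone fun x : X => v x := by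
  refine forall₄_congr fun A _ v _ => ?_
  rw [Formula.Holds, ← mem_nonnegCone_iff_zero_le, mem_nonnegCone, mem_nonnegCone, evalPoly_rename]

/-- Negated atoms contribute only to `notNonneg` and `notZero`. Hence blocking creates no new
positive parts, which bounds the number of iterations. -/
theorem nonneg_of_mem_dnf_not_blocked {G : Formula Y} {c : Cube Y}
    (hc : c ∈ (G.and (blocked Z P).not).dnf true) :
    ∃ d ∈ G.dnf true, c.nonneg = d.nonneg := by
  rw [Formula.dnf, List.mem_flatMap] at hc
  obtain ⟨d, hd, hc⟩ := hc
  obtain ⟨e, he, rfl⟩ := List.mem_map.mp hc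
  have : e.nonneg = [] := by
    rw [Formula.dnf, blocked, Formula.dnf, List.mem_append] at he
    rcases he with he | he
    all_goals
      refine Formula.nonneg_of_mem_dnf_false_conj ?_ e he
      intro F hF
      obtain ⟨z, _, rfl⟩ := List.mem_map.mp hF
      simp [Formula.dnf]
  exact ⟨d, hd, by rw [Cube.meet, this, List.append_nil]⟩

end LazyConsequence

/-! ### Correctness of saturation, and the invariants of the procedure. -/

namespace LazyConsequence

open LinearRealRing AlgCone

universe u

variable {Y : Type u} {X : Set Y}

/-- The polynomials that are non-negative in all models in which the elements of `L` are. -/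
def nonnegConsequences (L : List (MvPolynomial Y ℚ)) : Set (MvPolynomial Y ℚ) :=
  {p | ∀ (A : Type u) [LinearRealRing A] (v : Y → A),
    (∀ a ∈ L, a ∈ nonnegCone v) → p ∈ nonnegCone v}

/-- The invariant of the saturation loop. -/
structure SaturationInvariant (m : MonomialOrder Y) (c : Cube Y)
    (Z P : Finset (MvPolynomial Y ℚ)) : Prop where
  reduced : IsReducedPair m Z P
  nonneg : ∀ p ∈ c.nonneg, p ∈ algHull Z P
  one : 1 ∈ algHull Z P
  sound : ∀ (A : Type u) [LinearRealRing A] (v : Y → A),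
    (∀ p ∈ c.nonneg, p ∈ nonnegCone v) → algHull Z P ≤ nonnegCone v

namespace SaturationInvariant

variable {m : MonomialOrder Y} {c : Cube Y} {Z P : Finset (MvPolynomial Y ℚ)}

open scoped Classical in
theorem start (m : MonomialOrder Y) (c : Cube Y) :
    SaturationInvariant m c ∅ (insert 1 c.nonneg.toFinset) where
  reduced := by
    refine ⟨⟨by simp, rfl, fun f hf hf0 => ?_⟩, fun p _ => ⟨by simp, by simp⟩⟩
    simp only [ideal, Finset.coe_empty, Ideal.span_empty, Ideal.mem_bot] at hf
    exact absurd hf hf0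
  nonneg p hp := mem_algHull_of_mem_cone (mem_cone_of_mem
    (Finset.mem_insert_of_mem (List.mem_toFinset.mpr hp)))
  one := mem_algHull_of_mem_cone (mem_cone_of_mem (Finset.mem_insert_self _ _))
  sound A _ v h := by
    refine algHull_le_nonnegCone v (by simp) fun p hp => ?_
    rcases Finset.mem_insert.mp hp with rfl | hp
    · change (0 : A) ≤ evalHom v 1
      rw [map_one]
      exact zero_le_one'
    · exact h p (List.mem_toFinset.mp hp)

-- Equating a unit with zero is sound: `t` and `-t` are non-negative in every model of the positive
-- literals, so antisymmetry forces `t = 0`.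
open scoped Classical in
theorem unit (h : SaturationInvariant m c Z P) {t : MvPolynomial Y ℚ} (ht : IsNonzeroUnit P t)
    {Z' P' : Finset (MvPolynomial Y ℚ)} (hr : Reduce m (insert t Z) P Z' P') :
    SaturationInvariant m c Z' P' := by
  have hle : algHull Z P ≤ algHull Z' P' := by
    rw [hr.algHull_eq]
    refine algHull_le (fun f hf => mem_algHull_of_mem_ideal ?_)
      fun p hp => mem_algHull_of_mem_cone (mem_cone_of_mem hp)
    exact Ideal.span_mono (by simp) hf
  refine ⟨hr.isReducedPair, fun p hp => hle (h.nonneg p hp), hle h.one, fun A _ v hv => ?_⟩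
  have hs := h.sound A v hv
  rw [hr.algHull_eq, algHull_le_nonnegCone_iff]
  rw [algHull_le_nonnegCone_iff] at hs
  refine ⟨fun z hz => ?_, hs.2⟩
  rcases Finset.mem_insert.mp hz with rfl | hz
  · exact (eq_zero_iff_mem_nonnegCone v).mpr ⟨h.sound A v hv (mem_algHull_of_mem_cone ht.2.1),
      h.sound A v hv (mem_algHull_of_mem_cone ht.2.2)⟩
  · exact hs.1 z hz

-- `t` is non-zero and irreducible modulo the Gröbner basis `Z`, so it is not yet in the ideal.
open scoped Classical in
theorem ideal_lt (h : SaturationInvariant m c Z P) {t : MvPolynomial Y ℚ}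
    (ht : IsNonzeroUnit P t) {Z' P' : Finset (MvPolynomial Y ℚ)}
    (hr : Reduce m (insert t Z) P Z' P') : ideal Z < ideal Z' := by
  rw [hr.1.2.1]
  refine lt_of_le_of_ne (Ideal.span_mono (by simp)) fun e => ht.1 ?_
  refine h.reduced.1.eq_zero_of_mem_irreducibles ?_ (h.reduced.mem_irreducibles ht.2.1)
  rw [e]
  exact Ideal.subset_span (by simp)

theorem not_holds_of_refutes (h : SaturationInvariant m c Z P) (hc : Refutes m c Z P)
    {A : Type u} [LinearRealRing A] (v : Y → A) : ¬ c.Holds v := by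
  rintro ⟨h1, h2, h3⟩
  have hs := h.sound A v h1
  rcases hc with hc | ⟨q, hq, q', hqq', hq'⟩ | ⟨r, hr, hc⟩
  · have := eval_ideal_eq_zero v hs hc.1
    rw [sub_zero, evalPoly_eq_evalHom, map_one] at this
    exact zero_ne_one' this.symm
  · refine h2 q hq (hs ?_)
    have := add_mem (mem_algHull_of_mem_ideal (P := P) hqq'.1) (mem_algHull_of_mem_cone hq')
    simpa using this
  · exact h3 r hr (eval_ideal_eq_zero v hs (by simpa using hc.1))

/-- The model is the quotient by `ideal Z`. The tests in `Refutes` are complete because normal forms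
decide membership in both the ideal and the algebraic cone. -/
theorem exists_model (h : SaturationInvariant m c Z P) (hs : ∀ t, ¬ IsNonzeroUnit P t)
    (hc : ¬ Refutes m c Z P) : ∃ (A : Type u) (_ : LinearRealRing A) (v : Y → A),
      c.Holds v ∧ nonnegCone v = algHull Z P := by
  have hnf : ∀ p ∈ ideal Z, IsNormalForm m Z p 0 := fun p hp =>
    isNormalForm_iff.mpr ⟨by simpa using hp, zero_mem _⟩
  obtain ⟨A, _, v, hv⟩ := exists_nonnegCone_eq (ideal Z) (algHull Z P)
    (fun f hf => mem_algHull_of_mem_ideal hf) h.one (fun h1 => hc (Or.inl (hnf 1 h1)))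
    (fun f hf hf' => h.reduced.mem_ideal_of_units hs hf hf')
  refine ⟨A, _, v, ⟨?_, ?_, ?_⟩, hv⟩
  · exact fun p hp => hv ▸ h.nonneg p hp
  · intro q hq hqv
    rw [hv] at hqv
    obtain ⟨z, hz, p, hp, rfl⟩ := hqv
    exact hc (Or.inr (Or.inl ⟨_, hq, p, isNormalForm_iff.mpr
      ⟨by simpa using hz, h.reduced.mem_irreducibles hp⟩, hp⟩))
  · intro r hr hrv
    rw [eq_zero_iff_mem_nonnegCone, hv] at hrv
    exact hc (Or.inr (Or.inr ⟨r, hr, hnf r (h.reduced.mem_ideal_of_units hs hrv.1 hrv.2)⟩))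

end SaturationInvariant

/-- The invariant of the main loop. -/
structure LoopInvariant (m : MonomialOrder Y) (F G : Formula Y)
    (Z P : Finset (MvPolynomial X ℚ)) : Prop where
  holds_iff : ∀ (A : Type u) [LinearRealRing A] (v : Y → A),
    G.Holds v ↔ F.Holds v ∧ ¬ algHull Z P ≤ nonnegCone fun x : X => v x
  subset : F.consequenceCone X ⊆ algCone Z P
  nonneg : ∀ c ∈ G.dnf true, ∃ d ∈ F.dnf true, c.nonneg = d.nonneg
  reduced : IsReducedPair (m.restrict X) Z P

open scoped Classical in
/-- The lists of non-negative atoms of cubes of `F` that do not entail that all elements of the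
algebraic cone are non-negative. -/
noncomputable def uncovered (F : Formula Y) (Z P : Finset (MvPolynomial X ℚ)) :
    Finset (List (MvPolynomial Y ℚ)) :=
  ((F.dnf true).map Cube.nonneg).toFinset.filter fun L =>
    ¬ ∀ f ∈ algHull Z P, rename Subtype.val f ∈ nonnegConsequences L

namespace LoopInvariant

variable {m : MonomialOrder Y} {F G : Formula Y}

theorem start (m : MonomialOrder Y) (F : Formula Y) (X : Set Y) :
    LoopInvariant (X := X) m F F {1} {0} where
  holds_iff A _ v := by
    -- The initial algebraic cone contains -1 as well as 1, so no non-trivial ring makes all of it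
    -- non-negative and the extra condition is vacuous.
    refine ⟨fun h => ⟨h, fun hle => ?_⟩, And.left⟩
    have := eval_ideal_eq_zero _ hle (Ideal.subset_span (Finset.mem_coe.mpr
      (Finset.mem_singleton_self 1)))
    rw [evalPoly_eq_evalHom, map_one] at this
    exact zero_ne_one' this.symm
  subset f _ := mem_algHull_of_mem_ideal (by simp [ideal])
  nonneg c hc := ⟨c, hc, rfl⟩
  reduced := by
    refine ⟨⟨by simp, rfl, fun f _ _ => ⟨1, by simp, by simp⟩⟩, fun p hp => ?_⟩
    rw [Finset.mem_singleton.mp hp]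
    exact isNormalForm_iff.mpr ⟨by simp, zero_mem _⟩

variable {Z P : Finset (MvPolynomial X ℚ)} {c : Cube Y} {Z' P' : Finset (MvPolynomial Y ℚ)}
  {Z₁ P₁ Z₂ P₂ : Finset (MvPolynomial X ℚ)}

/-- The model `v` of `c` satisfies `G`, so some element of the old cone is not non-negative in it,
and `c.nonneg` is uncovered. The new cone lies in the projection of the saturation, all of which
follows from `c.nonneg`, so this list becomes covered. -/
theorem accept (h : LoopInvariant m F G Z P) (hcG : c ∈ G.dnf true)
    (hi : SaturationInvariant m c Z' P') (hs : ∀ t, ¬ IsNonzeroUnit P' t)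
    (hc : ¬ Refutes m c Z' P')
    (hpr : Project (m.elimination X) Subtype.val Z' P' Z₁ P₁)
    (hin : Intersect (m.restrict X) Z P Z₁ P₁ Z₂ P₂) :
    LoopInvariant m F (G.and (blocked Z₂ P₂).not) Z₂ P₂ ∧
      uncovered F Z₂ P₂ ⊂ uncovered F Z P := by
  classical
  obtain ⟨A, _, v, hcv, hv⟩ := hi.exists_model hs hc
  have hG : G.Holds v := (Formula.exists_dnf_holds v G).1.mp ⟨c, hcG, hcv⟩
  obtain ⟨hF, hnot⟩ := (h.holds_iff A v).mp hG
  have hmem : ∀ f, f ∈ algHull Z₂ P₂ ↔ f ∈ algHull Z P ∧ rename Subtype.val f ∈ algHull Z' P' :=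
    fun f => by
      rw [hin.mem_algHull_iff, Project.mem_algHull_iff (isElimination_elimination m X) hpr]
  have hle : algHull Z₂ P₂ ≤ algHull Z P := fun f hf => ((hmem f).mp hf).1
  refine ⟨⟨fun B _ w => ?_, fun f hf => ?_, fun d hd => ?_, hin.isReducedPair⟩,
    Finset.ssubset_iff_of_subset (fun L hL => ?_) |>.mpr ⟨c.nonneg, ?_, ?_⟩⟩
  · rw [Formula.Holds, Formula.Holds, h.holds_iff, holds_blocked_iff, and_assoc]
    exact and_congr_right fun _ => and_iff_right_of_imp fun hn hle' => hn (hle.trans hle')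
  · refine (hmem f).mpr ⟨h.subset hf, ?_⟩
    rw [← hv, mem_nonnegCone, evalPoly_rename]
    exact mem_consequenceCone_iff.mp hf A v hF
  · obtain ⟨e, he, hde⟩ := nonneg_of_mem_dnf_not_blocked hd
    obtain ⟨e', he', hee'⟩ := h.nonneg e he
    exact ⟨e', he', hde.trans hee'⟩
  · rw [uncovered, Finset.mem_filter] at hL ⊢
    exact ⟨hL.1, fun hall => hL.2 fun f hf => hall f (hle hf)⟩
  · rw [uncovered, Finset.mem_filter, List.mem_toFinset, List.mem_map]
    obtain ⟨d, hd, hcd⟩ := h.nonneg c hcG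
    refine ⟨⟨d, hd, hcd.symm⟩, fun hall => hnot fun f hf => ?_⟩
    rw [mem_nonnegCone, ← evalPoly_rename]
    exact hall f hf A v hcv.1
  · rw [uncovered, Finset.mem_filter]
    exact fun hn => hn.2 fun f hf B _ w hw => hi.sound B w hw ((hmem f).mp hf).2

end LoopInvariant

/-- The invariant of the procedure. -/
def Invariant (m : MonomialOrder Y) (F : Formula Y) : State X → Prop
  | .search G Z P L => LoopInvariant m F G Z P ∧ (∀ c ∈ L, c ∈ G.dnf true) ∧
      ∀ (A : Type u) [LinearRealRing A] (v : Y → A), G.Holds v → ∃ c ∈ L, c.Holds v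
  | .saturate G Z P L c Z' P' => LoopInvariant m F G Z P ∧ (∀ d ∈ c :: L, d ∈ G.dnf true) ∧
      (∀ (A : Type u) [LinearRealRing A] (v : Y → A), G.Holds v → ∃ d ∈ c :: L, d.Holds v) ∧
      SaturationInvariant m c Z' P'
  | .done Z P => IsReducedPair (m.restrict X) Z P ∧ algCone Z P = F.consequenceCone X

/-- The termination measure of the procedure. -/
noncomputable def rank (F : Formula Y) : State X → ℕ ×ₗ ℕ ×ₗ (Ideal (MvPolynomial Y ℚ))ᵒᵈ
  | .search _ Z P L => toLex ((uncovered F Z P).card, toLex (2 * L.length + 1, ⊥))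
  | .saturate _ Z P L _ Z' _ =>
      toLex ((uncovered F Z P).card, toLex (2 * L.length + 2, OrderDual.toDual (ideal Z')))
  | .done Z P => toLex ((uncovered F Z P).card, toLex (0, ⊥))

variable {m : MonomialOrder Y} {F : Formula Y}

theorem invariant_loopHead {G : Formula Y} {Z P : Finset (MvPolynomial X ℚ)}
    (h : LoopInvariant m F G Z P) : Invariant m F (loopHead G Z P) :=
  ⟨h, fun _ hc => hc, fun _ _ v hv => (Formula.exists_dnf_holds v G).1.mpr hv⟩

/-- In `rank`, accepting a cube lowers the first component. The values 2n + 1 and 2n + 2 make both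
selecting (from n + 1 to n remaining cubes) and rejecting decrease the second; a unit step enlarges
the ideal, which is ordered dually. The entry `⊥` is only a filler. -/
theorem Step.invariant_and_rank_lt {s s' : State X} (hs : Step m s s') (h : Invariant m F s) :
    Invariant m F s' ∧ rank F s' < rank F s := by
  classical
  have lt₁ : ∀ {k i j : ℕ} {I J : (Ideal (MvPolynomial Y ℚ))ᵒᵈ}, i < j →
      toLex (k, toLex (i, I)) < toLex (k, toLex (j, J)) := fun hij =>
    Prod.Lex.toLex_lt_toLex.mpr (Or.inr ⟨rfl, Prod.Lex.toLex_lt_toLex.mpr (Or.inl hij)⟩)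
  cases hs with
  | exit G Z P =>
    obtain ⟨hl, -, hG⟩ := h
    refine ⟨⟨hl.reduced, Set.Subset.antisymm (fun f hf => ?_) hl.subset⟩, lt₁ (by simp)⟩
    refine mem_consequenceCone_iff.mpr fun A _ v hv => ?_
    by_contra hfv
    obtain ⟨c, hc, -⟩ := hG A v ((hl.holds_iff A v).mpr ⟨hv, fun hle => hfv (hle hf)⟩)
    simp at hc
  | select G Z P L₁ L₂ c =>
    obtain ⟨hl, hL, hG⟩ := h
    have hmem : ∀ d, d ∈ c :: (L₁ ++ L₂) ↔ d ∈ L₁ ++ c :: L₂ := fun d =>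
      List.perm_middle.symm.mem_iff
    refine ⟨⟨hl, fun d hd => hL d ((hmem d).mp hd), fun A _ v hv => ?_, .start m c⟩, lt₁ ?_⟩
    · obtain ⟨d, hd, hdv⟩ := hG A v hv
      exact ⟨d, (hmem d).mpr hd, hdv⟩
    · simp only [List.length_append, List.length_cons]
      omega
  | unit G Z P L c Z' P' Z'' P'' t ht hr =>
    obtain ⟨hl, hL, hG, hi⟩ := h
    refine ⟨⟨hl, hL, hG, hi.unit ht hr⟩, Prod.Lex.toLex_lt_toLex.mpr (Or.inr ⟨rfl,
      Prod.Lex.toLex_lt_toLex.mpr (Or.inr ⟨rfl, ?_⟩)⟩)⟩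
    exact OrderDual.toDual_lt_toDual.mpr (hi.ideal_lt ht hr)
  | reject G Z P L c Z' P' hs hc =>
    obtain ⟨hl, hL, hG, hi⟩ := h
    refine ⟨⟨hl, fun d hd => hL d (List.mem_cons_of_mem _ hd), fun A _ v hv => ?_⟩,
      lt₁ (by omega)⟩
    obtain ⟨d, hd, hdv⟩ := hG A v hv
    rcases List.mem_cons.mp hd with rfl | hd
    · exact absurd hdv (hi.not_holds_of_refutes hc v)
    · exact ⟨d, hd, hdv⟩
  | accept G Z P L c Z' P' Z₁ P₁ Z₂ P₂ hs hc hp hi =>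
    obtain ⟨hl, hL, -, hsat⟩ := h
    obtain ⟨hl', hlt⟩ := hl.accept (hL c List.mem_cons_self) hsat hs hc hp hi
    exact ⟨invariant_loopHead hl',
      Prod.Lex.toLex_lt_toLex.mpr (Or.inl (Finset.card_lt_card hlt))⟩

/-- Finiteness of `Y` enters through the existence of Gröbner bases, which keeps every subroutine
from getting stuck. -/
theorem exists_step [Finite Y] (m : MonomialOrder Y) (s : State X) :
    (∃ Z P, s = State.done Z P) ∨ ∃ s', Step m s s' := by
  classical
  match s with
  | .done Z P => exact Or.inl ⟨Z, P, rfl⟩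
  | .search G Z P [] => exact Or.inr ⟨_, Step.exit G Z P⟩
  | .search G Z P (c :: L) => exact Or.inr ⟨_, Step.select G Z P [] L c⟩
  | .saturate G Z P L c Z' P' =>
    right
    by_cases hs : ∃ t, IsNonzeroUnit P' t
    · obtain ⟨t, ht⟩ := hs
      obtain ⟨Z'', P'', hr⟩ := exists_reduce m (insert t Z') P'
      exact ⟨_, Step.unit G Z P L c Z' P' Z'' P'' t ht hr⟩
    · rw [not_exists] at hs
      by_cases hc : Refutes m c Z' P'
      · exact ⟨_, Step.reject G Z P L c Z' P' hs hc⟩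
      · obtain ⟨Z₁, P₁, hp⟩ := exists_project (m.elimination X) Subtype.val_injective Z' P'
        obtain ⟨Z₂, P₂, hi⟩ := exists_intersect (m.restrict X) Z P Z₁ P₁
        exact ⟨_, Step.accept G Z P L c Z' P' Z₁ P₁ Z₂ P₂ hs hc hp hi⟩

end LazyConsequence

theorem mainTheorem1 {Y : Type*} [Finite Y] (m : MonomialOrder Y) (F : Formula Y) (X : Set Y) :
    -- there is no infinite execution
    (¬ ∃ run : ℕ → LazyConsequence.State X, run 0 = LazyConsequence.init F X ∧
      ∀ n, LazyConsequence.Step m (run n) (run (n + 1))) ∧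
    -- and every execution that cannot be continued has returned a correct result
    (∀ s : LazyConsequence.State X,
      Relation.ReflTransGen (LazyConsequence.Step m) (LazyConsequence.init F X) s →
      (∀ s', ¬ LazyConsequence.Step m s s') →
      ∃ Z P : Finset (MvPolynomial X ℚ), s = LazyConsequence.State.done Z P ∧
        AlgCone.IsReducedPair (m.restrict X) Z P ∧
        AlgCone.algCone Z P = F.consequenceCone X) := by
  have hinit : LazyConsequence.Invariant m F (LazyConsequence.init F X) :=
    LazyConsequence.invariant_loopHead (.start m F X)
  constructor
  · rintro ⟨run, h0, hstep⟩
    have hinv : ∀ n, LazyConsequence.Invariant m F (run n) := fun n => by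
      induction n with
      | zero => exact h0 ▸ hinit
      | succ n ih => exact ((hstep n).invariant_and_rank_lt ih).1
    -- The ranks would descend forever; the order on them is well-founded because ℚ[Y] is Noetherian
    -- for finite `Y`.
    exact (RelEmbedding.natGT (r := (· < ·)) (fun n => LazyConsequence.rank F (run n))
      fun n => ((hstep n).invariant_and_rank_lt (hinv n)).2).not_wellFounded wellFounded_lt
  · intro s hs hstuck
    have hinv : LazyConsequence.Invariant m F s := by
      clear hstuck
      induction hs with
      | refl => exact hinit
      | tail _ hstep ih => exact (hstep.invariant_and_rank_lt ih).1
    rcases LazyConsequence.exists_step m s with ⟨Z, P, rfl⟩ | ⟨s', hs'⟩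
    · exact ⟨Z, P, rfl, hinv.1, hinv.2⟩
    · exact absurd hs' (hstuck s')
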